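/- Let $m,\tilde m,n\in\mathbb Z_{\ge 0}$. For a non-zero vector $v=|v|(\cos\varphi,\sin\varphi)\in\mathbb R^2$ put $z(v)=e^{2i\varphi}$. A configuration $\mathcal A_{(m,\tilde m,1^n)}$ consists of pairwise non-collinear vectors $\alpha_0,\dots,\alpha_{n+1}\in\mathbb R^2$ with multiplicities $m_0=m$, $m_1=\dots=m_n=1$, $m_{n+1}=\tilde m$, such that $\alpha_0$ and $\alpha_{n+1}$ are orthogonal, the arrangement of the lines $(\alpha_i,x)=0$, $0\le i\le n+1$, is symmetric with respect to the reflection about $\alpha_0$, and, with $z_i=z(\alpha_i)$, $$\sum_{\substack{0\le i\le n+1\\ i\ne j}} m_i\,\frac{z_i+z_j}{z_i-z_j}=0\qquad\text{for all } j=1,\dots,n .\tag{$z_j(1)$}$$ Theorem. If $n$ is even, then a configuration $\mathcal A_{(m,\tilde m,1^n)}$ exists; and every configuration $\mathcal A_{(m,\tilde m,1^n)}$ admits a Baker-Akhiezer function, that is, a function $\phi(\lambda,x)$ of $\lambda,x\in\mathbb C^2$ such that, with $(a,b)=a_1b_1+a_2b_2$ on $\mathbb C^2$, 1. $\phi(\lambda,x)=P(\lambda,x)e^{(\lambda,x)}$,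 where $P$ is a polynomial in $\lambda$ and $x$ with highest term $\prod_{i=0}^{n+1}(\alpha_i,\lambda)^{m_i}(\alpha_i,x)^{m_i}$, i.e. $P$ has total degree at most $2\sum_i m_i$ and this product is its homogeneous component of degree $2\sum_i m_i$; 2. for all $i=0,\dots,n+1$ and all $1\le s\le m_i$, $\partial_{\alpha_i}^{2s-1}\phi(\lambda,x)=0$ whenever $(\alpha_i,x)=0$, where $\partial_{\alpha_i}=(\alpha_i,\partial/\partial x)$. -/

import Mathlib

noncomputable section

namespace BakerAkhiezer

/-- The standard bilinear product `(a, x) = ∑ aᵢ xᵢ`, for a constant vector `a ∈ ℂ^N` and the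
coordinates `x₁, …, x_N` which are the variables `X (v i)` of a polynomial ring: the linear form
`(a, x)` as a polynomial. -/
def linForm {N : ℕ} {σ : Type*} (v : Fin N → σ) (a : Fin N → ℂ) : MvPolynomial σ ℂ :=
  ∑ i, MvPolynomial.C (a i) * MvPolynomial.X (v i)

/-- The polynomial `∏ᵢ (αᵢ, λ)^{mᵢ} (αᵢ, x)^{mᵢ}` in the variables `λ` (`Sum.inl`) and `x`
(`Sum.inr`). It is homogeneous of degree `2 ∑ mᵢ`. -/
def leadingTerm {ι : Type*} [Fintype ι] {N : ℕ} (α : ι → Fin N → ℂ) (m : ι → ℕ) :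
    MvPolynomial (Fin N ⊕ Fin N) ℂ :=
  ∏ i, (linForm Sum.inl (α i) ^ m i * linForm Sum.inr (α i) ^ m i)

/-- The directional derivative `∂_a = (a, ∂/∂x)` on functions on `ℂ^N`. -/
def dirDeriv {N : ℕ} (a : Fin N → ℂ) (f : (Fin N → ℂ) → ℂ) : (Fin N → ℂ) → ℂ :=
  fun x => lineDeriv ℂ f x a

/-- `φ(λ, x)` is a Baker-Akhiezer function of the configuration of vectors `αᵢ ∈ ℂ^N` with
multiplicities `mᵢ`:
* `φ(λ, x) = P(λ, x) e^{(λ, x)}` with `P` a polynomial in `λ` and `x` whose highest term is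
  `∏ᵢ (αᵢ, λ)^{mᵢ} (αᵢ, x)^{mᵢ}`;
* `∂_{αᵢ}^{2s-1} φ = 0` on the hyperplane `(αᵢ, x) = 0`, for every `i` and `1 ≤ s ≤ mᵢ`. -/
structure IsBAFunction {ι : Type*} [Fintype ι] {N : ℕ} (α : ι → Fin N → ℂ) (m : ι → ℕ)
    (φ : (Fin N → ℂ) → (Fin N → ℂ) → ℂ) : Prop where
  form : ∃ P : MvPolynomial (Fin N ⊕ Fin N) ℂ,
    P.totalDegree ≤ 2 * ∑ i, m i ∧
    MvPolynomial.homogeneousComponent (2 * ∑ i, m i) P = leadingTerm α m ∧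
    ∀ l x : Fin N → ℂ, φ l x = MvPolynomial.eval (Sum.elim l x) P * Complex.exp (l ⬝ᵥ x)
  vanish : ∀ i, ∀ s : ℕ, 1 ≤ s → s ≤ m i → ∀ l x : Fin N → ℂ, α i ⬝ᵥ x = 0 →
    (dirDeriv (α i))^[2 * s - 1] (φ l) x = 0

/-- `z = e^{2iφ}`, where `φ` is the polar angle of `v ∈ ℝ²`, that is, `v = |v| (cos φ, sin φ)`.
It does not change if `v` is multiplied by a nonzero real number. -/
def zCoord (v : EuclideanSpace ℝ (Fin 2)) : ℂ :=
  Complex.exp (2 * Complex.I * (Complex.arg ⟨v 0, v 1⟩ : ℂ))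

/-- The condition `(z_j(k))` for a planar configuration with multiplicities `mᵢ`:
`∑_{i ≠ j} mᵢ (zᵢ + z_j)^{2k-1} / (zᵢ - z_j)^{2k-1} = 0`. -/
def ZCondition {ι : Type*} [Fintype ι] [DecidableEq ι] (α : ι → EuclideanSpace ℝ (Fin 2))
    (m : ι → ℕ) (j : ι) (k : ℕ) : Prop :=
  ∑ i ∈ Finset.univ.erase j,
    (m i : ℂ) * (zCoord (α i) + zCoord (α j)) ^ (2 * k - 1) /
      (zCoord (α i) - zCoord (α j)) ^ (2 * k - 1) = 0

/-- The multiplicities `m₀ = m`, `m₁ = ⋯ = m_n = 1`, `m_{n+1} = m'`. -/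
def mult (m m' n : ℕ) (i : Fin (n + 2)) : ℕ :=
  if i = 0 then m else if i = Fin.last (n + 1) then m' else 1

/-- The arrangement of the lines `(αᵢ, x) = 0` in `ℝ²`. -/
def arrangement {ι : Type*} (α : ι → EuclideanSpace ℝ (Fin 2)) :
    Set (Submodule ℝ (EuclideanSpace ℝ (Fin 2))) :=
  Set.range fun i => (Submodule.span ℝ {α i})ᗮ

/-- The orthogonal reflection of `ℝ²` in the line `(a, x) = 0`. (The reflection in the line
spanned by `a` is its negative, so both act in the same way on lines through the origin.) -/
def reflectionAbout (a : EuclideanSpace ℝ (Fin 2)) :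
    EuclideanSpace ℝ (Fin 2) ≃ₗᵢ[ℝ] EuclideanSpace ℝ (Fin 2) :=
  (Submodule.span ℝ {a})ᗮ.reflection

/-- The vectors `α₀, …, α_{n+1} ∈ ℝ²`, taken with the multiplicities `m, 1, …, 1, m'`, form a
configuration `𝒜_{(m, m', 1ⁿ)}`. -/
structure IsSymmetricConfig (m m' n : ℕ) (α : Fin (n + 2) → EuclideanSpace ℝ (Fin 2)) :
    Prop where
  noncollinear : ∀ i j, i ≠ j → LinearIndependent ℝ ![α i, α j]
  orthogonal : inner ℝ (α 0) (α (Fin.last (n + 1))) = 0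
  symmetric : (fun L => L.map (reflectionAbout (α 0)).toLinearMap) '' arrangement α
    = arrangement α
  zCondition : ∀ j, j ≠ 0 → j ≠ Fin.last (n + 1) → ZCondition α (mult m m' n) j 1

/-- Real vectors of the plane, regarded as vectors of `ℂ²`. -/
def complexify {ι : Type*} (α : ι → EuclideanSpace ℝ (Fin 2)) : ι → Fin 2 → ℂ :=
  fun i k => ((α i k : ℝ) : ℂ)

end BakerAkhiezer

end

open MvPolynomial

noncomputable section

namespace BakerAkhiezer

/-! The Baker-Akhiezer function comes from a formula of Berest type. Put A = ∏ (αᵢ, x)^{mᵢ}, M = ∑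
mᵢ, and let D be the gauged Calogero-Moser operator Δ - ∑ 2mᵢ (αᵢ, x)⁻¹ ∂_{αᵢ}, shifted by -λ² and
conjugated by e^{(λ, x)}, so that everything happens among polynomials. The vanishing conditions
(quasi-invariance) hold for A² because it vanishes to order 2mⱼ on the j-th line. If D preserves
them, then D^M A² satisfies them too. On the component of degree 2M, D acts as A g ↦ 2A (λ, ∂/∂x) g,
so the top component of D^M A² is 2^M M! ∏ (αᵢ, λ)^{mᵢ} (αᵢ, x)^{mᵢ}; it remains to divide by the
constant (`IsLocus.exists_poly`).

That D preserves quasi-invariance (`IsLocus.quasiInvariant`) is checked line by line. The Laplacian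
and the j-th singular term together behave as in rank one (`restrict_twistedLapl_sub`). The other
singular terms cancel provided ∑ mᵢ cot^{2s+1} ∠(αⱼ, αᵢ) = 0 for all s < mⱼ
(`sum_restrict_quotient`). For a symmetric configuration this holds at both axes, whatever m and m̃,
because the reflection changes the sign of the cotangents; at a middle vector only s = 0 is
required, and this is the condition on the zᵢ, since (zᵢ + zⱼ)/(zᵢ - zⱼ) = -i cot ∠(αⱼ, αᵢ).

For existence, the middle vectors are taken as unit vectors at angles ±θ_k from α₀. In the variables
x_k = sin² θ_k the conditions become the Stieltjes equilibrium equations of a Jacobi weight on (0,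
1), solved by maximising a weighted discriminant (`exists_equilibrium`). -/

/-- Polynomials in the variables `λ` (`Sum.inl`) and `x` (`Sum.inr`) of the plane. -/
abbrev PlanePoly := MvPolynomial (Fin 2 ⊕ Fin 2) ℂ

/-! ### Derivatives conjugated by the exponential -/

/-- The operator `∂/∂x_k + λ_k`, which is `∂/∂x_k` conjugated by `e^{(λ, x)}`. -/
def twistedPartial (k : Fin 2) : Module.End ℂ PlanePoly :=
  (pderiv (Sum.inr k)).toLinearMap + LinearMap.mulLeft ℂ (X (Sum.inl k))

/-- The operator `∂_a + (a, λ)`, which is `∂_a` conjugated by `e^{(λ, x)}`. -/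
def twistedDeriv (a : Fin 2 → ℂ) : Module.End ℂ PlanePoly :=
  a 0 • twistedPartial 0 + a 1 • twistedPartial 1

/-- The vector `a` rotated by a right angle. -/
def rot (a : Fin 2 → ℂ) : Fin 2 → ℂ := ![-a 1, a 0]

@[simp] lemma rot_zero (a : Fin 2 → ℂ) : rot a 0 = -a 1 := rfl

@[simp] lemma rot_one (a : Fin 2 → ℂ) : rot a 1 = a 0 := rfl

lemma dotProduct_two (a c : Fin 2 → ℂ) : a ⬝ᵥ c = a 0 * c 0 + a 1 * c 1 := by
  simp [dotProduct, Fin.sum_univ_two]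

lemma twistedPartial_apply (k : Fin 2) (f : PlanePoly) :
    twistedPartial k f = pderiv (Sum.inr k) f + X (Sum.inl k) * f := rfl

lemma twistedDeriv_apply (a : Fin 2 → ℂ) (f : PlanePoly) :
    twistedDeriv a f = C (a 0) * twistedPartial 0 f + C (a 1) * twistedPartial 1 f := by
  simp [twistedDeriv, smul_eq_C_mul]

lemma linForm_two (v : Fin 2 → Fin 2 ⊕ Fin 2) (a : Fin 2 → ℂ) :
    linForm v a = C (a 0) * X (v 0) + C (a 1) * X (v 1) := by
  simp [linForm, Fin.sum_univ_two]

lemma pderiv_comm (i j : Fin 2 ⊕ Fin 2) (f : PlanePoly) :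
    pderiv i (pderiv j f) = pderiv j (pderiv i f) := by
  have h : ⁅pderiv (R := ℂ) i, pderiv (R := ℂ) j⁆ = 0 := by
    ext k
    simp [Derivation.commutator_apply, pderiv_X, Pi.single_apply, apply_ite]
  have h2 := congrArg (fun d => d f) h
  simpa [Derivation.commutator_apply, sub_eq_zero] using h2

lemma commute_twistedPartial (i j : Fin 2) : Commute (twistedPartial i) (twistedPartial j) := by
  refine LinearMap.ext fun f => ?_
  simp only [Module.End.mul_apply, twistedPartial_apply, map_add, pderiv_mul,
    pderiv_X_of_ne (R := ℂ) (Sum.inl_ne_inr), pderiv_comm (Sum.inr i) (Sum.inr j)]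
  ring

lemma commute_twistedDeriv (a c : Fin 2 → ℂ) : Commute (twistedDeriv a) (twistedDeriv c) := by
  have h (i j) := commute_twistedPartial i j
  unfold twistedDeriv
  exact ((((h 0 0).smul_left _).smul_right _).add_right (((h 0 1).smul_left _).smul_right
      _)).add_left
    ((((h 1 0).smul_left _).smul_right _).add_right (((h 1 1).smul_left _).smul_right _))

lemma twistedDeriv_linForm_mul (a c : Fin 2 → ℂ) (f : PlanePoly) :
    twistedDeriv a (linForm Sum.inr c * f) =
      C (a ⬝ᵥ c) * f + linForm Sum.inr c * twistedDeriv a f := by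
  simp only [twistedDeriv_apply, twistedPartial_apply, linForm_two, dotProduct_two, pderiv_mul,
    map_add, map_mul, pderiv_C, pderiv_X]
  simp
  ring

lemma twistedDeriv_C_mul (a : Fin 2 → ℂ) (c : ℂ) (f : PlanePoly) :
    twistedDeriv a (C c * f) = C c * twistedDeriv a f := by
  rw [← smul_eq_C_mul, ← smul_eq_C_mul, map_smul]

/-- Leibniz rule for a power of an operator and a factor whose second derivative vanishes. -/
lemma pow_succ_apply_mul {A : Type*} [CommRing A] [Algebra ℂ A] {T : Module.End ℂ A} {u w : A}
    (hu : ∀ g, T (u * g) = w * g + u * T g) (hw : ∀ g, T (w * g) = w * T g) (k : ℕ) (g : A) :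
    (T ^ (k + 1)) (u * g) = u * (T ^ (k + 1)) g + ((k + 1 : ℕ) : A) * (w * (T ^ k) g) := by
  induction k with
  | zero => simp [hu]; ring
  | succ k ih =>
    have h : ∀ g, T (((k + 1 : ℕ) : A) * g) = ((k + 1 : ℕ) : A) * T g := fun g => by
      rw [← nsmul_eq_mul, ← nsmul_eq_mul, map_nsmul]
    rw [pow_succ', Module.End.mul_apply, ih, map_add, hu, h, hw, ← Module.End.mul_apply,
      ← pow_succ', ← Module.End.mul_apply, ← pow_succ']
    push_cast
    ring

lemma twistedDeriv_pow_linForm_mul (a c : Fin 2 → ℂ) (k : ℕ) (f : PlanePoly) :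
    (twistedDeriv a ^ (k + 1)) (linForm Sum.inr c * f) =
      linForm Sum.inr c * (twistedDeriv a ^ (k + 1)) f +
        ((k + 1 : ℕ) : PlanePoly) * (C (a ⬝ᵥ c) * (twistedDeriv a ^ k) f) :=
  pow_succ_apply_mul (twistedDeriv_linForm_mul a c) (fun g => twistedDeriv_C_mul a _ g) k f

lemma twistedDeriv_pow_C_mul (a : Fin 2 → ℂ) (k : ℕ) (c : ℂ) (f : PlanePoly) :
    (twistedDeriv a ^ k) (C c * f) = C c * (twistedDeriv a ^ k) f := by
  rw [← smul_eq_C_mul, ← smul_eq_C_mul, map_smul]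

/-- The operator `(λ, ∂/∂x)`. -/
def lamDeriv : Derivation ℂ PlanePoly PlanePoly :=
  (X (Sum.inl 0) : PlanePoly) • pderiv (Sum.inr 0) + (X (Sum.inl 1) : PlanePoly) • pderiv (Sum.inr
      1)

/-- The Laplace operator in `x`. -/
def lapl (f : PlanePoly) : PlanePoly :=
  pderiv (Sum.inr 0) (pderiv (Sum.inr 0) f) + pderiv (Sum.inr 1) (pderiv (Sum.inr 1) f)

lemma lamDeriv_apply (f : PlanePoly) : lamDeriv f =
    X (Sum.inl 0) * pderiv (Sum.inr 0) f + X (Sum.inl 1) * pderiv (Sum.inr 1) f := by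
  simp [lamDeriv]

/-- The operator `Δ + 2 (λ, ∂/∂x)`, which is `Δ - λ²` conjugated by `e^{(λ, x)}`. -/
def twistedLapl (f : PlanePoly) : PlanePoly := lapl f + 2 * lamDeriv f

lemma twistedLapl_eq (f : PlanePoly) : twistedLapl f =
    twistedPartial 0 (twistedPartial 0 f) + twistedPartial 1 (twistedPartial 1 f) -
      (X (Sum.inl 0) ^ 2 + X (Sum.inl 1) ^ 2) * f := by
  simp only [twistedLapl, lapl, lamDeriv_apply, twistedPartial_apply, map_add, pderiv_mul,
    pderiv_X_of_ne (Sum.inl_ne_inr)]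
  ring

lemma twistedDeriv_mul_lam (a : Fin 2 → ℂ) (f : PlanePoly) :
    twistedDeriv a ((X (Sum.inl 0) ^ 2 + X (Sum.inl 1) ^ 2) * f) =
      (X (Sum.inl 0) ^ 2 + X (Sum.inl 1) ^ 2) * twistedDeriv a f := by
  simp only [twistedDeriv_apply, twistedPartial_apply, pderiv_mul, map_add, pderiv_pow,
    pderiv_X_of_ne (Sum.inl_ne_inr)]
  ring

/-- The vectors a and `rot a` are orthogonal with the same square (a, a), so (a, a)Δ = ∂_a² + ∂_{rot
a}²; conjugation produces the λ² term. -/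
lemma C_mul_twistedLapl (a : Fin 2 → ℂ) (f : PlanePoly) :
    C (a ⬝ᵥ a) * twistedLapl f = (twistedDeriv a ^ 2) f + (twistedDeriv (rot a) ^ 2) f -
      C (a ⬝ᵥ a) * ((X (Sum.inl 0) ^ 2 + X (Sum.inl 1) ^ 2) * f) := by
  have h : twistedPartial 0 (twistedPartial 1 f) = twistedPartial 1 (twistedPartial 0 f) :=
    LinearMap.congr_fun (commute_twistedPartial 0 1) f
  rw [twistedLapl_eq]
  simp only [pow_two (twistedDeriv a), pow_two (twistedDeriv (rot a)), Module.End.mul_apply]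
  simp only [twistedDeriv, LinearMap.add_apply, LinearMap.smul_apply, map_add, map_smul,
    h, rot_zero, rot_one, dotProduct_two, map_mul]
  simp only [smul_eq_C_mul, map_neg]
  ring

/-! ### Restriction to a line of the arrangement -/

/-- Restriction of polynomials to the line `(a, x) = 0`. -/
def restrict (a : Fin 2 → ℂ) : PlanePoly →ₐ[ℂ] PlanePoly :=
  aeval (Sum.elim (fun k => X (Sum.inl k))
    (fun k => C (rot a k / (a ⬝ᵥ a)) * linForm Sum.inr (rot a)))

lemma restrict_linForm (a c : Fin 2 → ℂ) :
    restrict a (linForm Sum.inr c) = C (rot a ⬝ᵥ c / (a ⬝ᵥ a)) * linForm Sum.inr (rot a) := by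
  rw [linForm_two Sum.inr c, dotProduct_two (rot a), add_div, C_add, add_mul]
  simp only [restrict, map_add, map_mul, aeval_X, Sum.elim_inr, algHom_C, algebraMap_eq,
    ← mul_assoc]
  simp only [← map_mul]
  ring_nf

lemma restrict_linForm_self (a : Fin 2 → ℂ) : restrict a (linForm Sum.inr a) = 0 := by
  rw [restrict_linForm, dotProduct_two (rot a)]
  simp [mul_comm]

lemma rot_dotProduct_rot (a : Fin 2 → ℂ) : rot a ⬝ᵥ rot a = a ⬝ᵥ a := by
  simp; ring

lemma linForm_ne_zero {a : Fin 2 → ℂ} (ha : a ⬝ᵥ a ≠ 0) : linForm Sum.inr a ≠ (0 : PlanePoly) := by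
  intro h
  have := congrArg (eval (Sum.elim (fun _ => 0) a)) h
  rw [linForm_two] at this
  simp only [map_add, map_mul, eval_C, eval_X, Sum.elim_inr, map_zero] at this
  exact ha (by rw [dotProduct_two]; exact this)

/-- A polynomial is divisible by `(a, x)` if and only if it vanishes on the line `(a, x) = 0`. -/
lemma linForm_dvd_iff {a : Fin 2 → ℂ} (ha : a ⬝ᵥ a ≠ 0) (f : PlanePoly) :
    linForm Sum.inr a ∣ f ↔ restrict a f = 0 := by
  constructor
  · rintro ⟨g, rfl⟩
    rw [map_mul, restrict_linForm_self, zero_mul]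
  · intro h
    let I := Ideal.span {(linForm Sum.inr a : PlanePoly)}
    -- `restrict a` substitutes for x its projection along a, which differs from x by (a, x) a / (a,
    -- a); it is therefore the identity modulo (a, x).
    have key : (Ideal.Quotient.mkₐ ℂ I).comp (restrict a) = Ideal.Quotient.mkₐ ℂ I := by
      refine MvPolynomial.algHom_ext fun k => ?_
      simp only [AlgHom.comp_apply, Ideal.Quotient.mkₐ_eq_mk]
      rw [Ideal.Quotient.eq, Ideal.mem_span_singleton]
      rcases k with k | k
      · simp [restrict]
      · refine ⟨C (-a k / (a ⬝ᵥ a)), ?_⟩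
        have h1 : (X (Sum.inr k) : PlanePoly) = C ((a ⬝ᵥ a) / (a ⬝ᵥ a)) * X (Sum.inr k) := by
          rw [div_self ha, C_1, one_mul]
        simp only [restrict, aeval_X, Sum.elim_inr]
        rw [h1]
        simp only [div_eq_mul_inv, C_mul, linForm_two, dotProduct_two a a, C_add]
        fin_cases k <;> simp <;> ring
    have h2 := congrArg (fun φ => φ f) key
    simp only [AlgHom.comp_apply, h, map_zero] at h2
    rw [Ideal.Quotient.mkₐ_eq_mk, eq_comm, Ideal.Quotient.eq_zero_iff_mem,
      Ideal.mem_span_singleton] at h2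
    exact h2

/-- `rot a` is tangent to the line (a, x) = 0, so differentiating along it preserves the ideal
generated by (a, x). -/
lemma restrict_twistedDeriv_rot {a : Fin 2 → ℂ} (ha : a ⬝ᵥ a ≠ 0) {f : PlanePoly}
    (h : restrict a f = 0) : restrict a (twistedDeriv (rot a) f) = 0 := by
  obtain ⟨g, rfl⟩ := (linForm_dvd_iff ha f).2 h
  have : rot a ⬝ᵥ a = 0 := by simp; ring
  rw [twistedDeriv_linForm_mul, this, C_0, zero_mul, zero_add, map_mul, restrict_linForm_self,
    zero_mul]

/-! ### Local analysis of the Calogero-Moser operator on one line -/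

/-- The cotangent of the angle between `a` and `c`. -/
def cotAngle (a c : Fin 2 → ℂ) : ℂ := (a ⬝ᵥ c) / (rot a ⬝ᵥ c)

lemma C_mul_cancel {c : ℂ} (hc : c ≠ 0) {f g : PlanePoly} (h : C c * f = C c * g) : f = g :=
  mul_left_cancel₀ (by simpa using hc) h

lemma restrict_C_mul (a : Fin 2 → ℂ) (c : ℂ) (f : PlanePoly) :
    restrict a (C c * f) = C c * restrict a f := by
  rw [map_mul, algHom_C, algebraMap_eq]

lemma twistedDeriv_pow_comm (a c : Fin 2 → ℂ) (k l : ℕ) (f : PlanePoly) :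
    (twistedDeriv a ^ k) ((twistedDeriv c ^ l) f) = (twistedDeriv c ^ l) ((twistedDeriv a ^ k) f) :=
  LinearMap.congr_fun ((commute_twistedDeriv a c).pow_pow k l) f

lemma twistedDeriv_pow_mul_lam (a : Fin 2 → ℂ) (k : ℕ) (f : PlanePoly) :
    (twistedDeriv a ^ k) ((X (Sum.inl 0) ^ 2 + X (Sum.inl 1) ^ 2) * f) =
      (X (Sum.inl 0) ^ 2 + X (Sum.inl 1) ^ 2) * (twistedDeriv a ^ k) f := by
  induction k with
  | zero => rfl
  | succ k ih =>
    rw [pow_succ', Module.End.mul_apply, ih, twistedDeriv_mul_lam, Module.End.mul_apply]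

/-- In the frame a, `rot a`, only ∂_a² survives on the line: the tangential derivatives and the
factor λ² act on a polynomial that already vanishes there. -/
lemma restrict_twistedLapl {a : Fin 2 → ℂ} (ha : a ⬝ᵥ a ≠ 0) {f : PlanePoly} {k : ℕ}
    (h : restrict a ((twistedDeriv a ^ k) f) = 0) :
    C (a ⬝ᵥ a) * restrict a ((twistedDeriv a ^ k) (twistedLapl f)) =
      restrict a ((twistedDeriv a ^ (k + 2)) f) := by
  rw [← restrict_C_mul, ← twistedDeriv_pow_C_mul, C_mul_twistedLapl, map_sub, map_add,
    twistedDeriv_pow_C_mul, twistedDeriv_pow_mul_lam, twistedDeriv_pow_comm a (rot a) k 2,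
    ← Module.End.mul_apply (twistedDeriv a ^ k), ← pow_add, map_sub, map_add, map_mul,
        map_mul _ _ ((twistedDeriv a ^ k) f), h,
    pow_two (twistedDeriv (rot a)), Module.End.mul_apply,
    restrict_twistedDeriv_rot ha (restrict_twistedDeriv_rot ha h)]
  ring

lemma C_mul_twistedDeriv (a c : Fin 2 → ℂ) (f : PlanePoly) : C (a ⬝ᵥ a) * twistedDeriv c f =
    C (a ⬝ᵥ c) * twistedDeriv a f + C (rot a ⬝ᵥ c) * twistedDeriv (rot a) f := by
  simp only [twistedDeriv_apply, dotProduct_two, rot_zero, rot_one, map_add, map_mul, map_neg]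
  ring

/-- A recursion in k for the normal derivatives of q: differentiate (c, x) q = ∂_c f along a and
restrict, with c resolved in the frame a, `rot a`. -/
lemma restrict_twistedDeriv_pow_quotient {a c : Fin 2 → ℂ} {f q : PlanePoly}
    (hq : linForm Sum.inr c * q = twistedDeriv c f) (ha : a ⬝ᵥ a ≠ 0) (k : ℕ) :
    C (rot a ⬝ᵥ c) * (linForm Sum.inr (rot a) * restrict a ((twistedDeriv a ^ (k + 1)) q)) +
      C (a ⬝ᵥ a) * (((k + 1 : ℕ) : PlanePoly) * (C (a ⬝ᵥ c) * restrict a ((twistedDeriv a ^ k) q)))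
          =
    C (a ⬝ᵥ c) * restrict a ((twistedDeriv a ^ (k + 2)) f) +
      C (rot a ⬝ᵥ c) * restrict a (twistedDeriv (rot a) ((twistedDeriv a ^ (k + 1)) f)) := by
  have h1 := twistedDeriv_pow_linForm_mul a c k q
  have h3 := congrArg (fun g => restrict a ((twistedDeriv a ^ (k + 1)) g)) (C_mul_twistedDeriv a c
      f)
  rw [← hq] at h3
  have h4 : (twistedDeriv a ^ (k + 1)) (twistedDeriv (rot a) f) =
      twistedDeriv (rot a) ((twistedDeriv a ^ (k + 1)) f) := by
    simpa using twistedDeriv_pow_comm a (rot a) (k + 1) 1 f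
  simp only [map_add, twistedDeriv_pow_C_mul, restrict_C_mul, h1, h4] at h3
  rw [← Module.End.mul_apply, ← pow_succ, map_mul, restrict_linForm, map_mul, map_natCast,
    restrict_C_mul] at h3
  have h5 : (C (a ⬝ᵥ a) * C (rot a ⬝ᵥ c / a ⬝ᵥ a) : PlanePoly) = C (rot a ⬝ᵥ c) := by
    rw [← C_mul, mul_div_cancel₀ _ ha]
  rw [← h3, ← h5]
  ring

lemma restrict_quotient {a c : Fin 2 → ℂ} {f q : PlanePoly}
    (hq : linForm Sum.inr c * q = twistedDeriv c f) (ha : a ⬝ᵥ a ≠ 0) :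
    C (rot a ⬝ᵥ c) * (linForm Sum.inr (rot a) * restrict a q) =
    C (a ⬝ᵥ c) * restrict a (twistedDeriv a f) +
      C (rot a ⬝ᵥ c) * restrict a (twistedDeriv (rot a) f) := by
  have h3 := congrArg (restrict a) (C_mul_twistedDeriv a c f)
  rw [← hq] at h3
  simp only [map_add, restrict_C_mul, map_mul _ _ q, restrict_linForm] at h3
  have h5 : (C (a ⬝ᵥ a) * C (rot a ⬝ᵥ c / a ⬝ᵥ a) : PlanePoly) = C (rot a ⬝ᵥ c) := by
    rw [← C_mul, mul_div_cancel₀ _ ha]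
  rw [← h3, ← h5]
  ring

/-- The rank-one computation: up to the factor (a, a), the left side is (1 - m/(s+1)) times the
restriction of the (2s+3)-rd normal derivative of f. That derivative vanishes by hypothesis if s + 1
< m, and the coefficient vanishes if s + 1 = m. -/
lemma restrict_twistedLapl_sub {a : Fin 2 → ℂ} (ha : a ⬝ᵥ a ≠ 0) {f q : PlanePoly} {m : ℕ}
    (hf : ∀ s < m, restrict a ((twistedDeriv a ^ (2 * s + 1)) f) = 0)
    (hq : linForm Sum.inr a * q = twistedDeriv a f) {s : ℕ} (hs : s < m) :
    restrict a ((twistedDeriv a ^ (2 * s + 1)) (twistedLapl f - C (2 * (m : ℂ)) * q)) = 0 := by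
  have h0 : rot a ⬝ᵥ a = 0 := by simp; ring
  have h1 := restrict_twistedLapl ha (hf s hs)
  have h2 := restrict_twistedDeriv_pow_quotient hq ha (2 * s + 1)
  rw [h0, C_0, zero_mul, zero_mul, zero_add, add_zero] at h2
  have h3 := C_mul_cancel ha h2
  rw [show ((2 * s + 1 + 1 : ℕ) : PlanePoly) = C (2 * (s + 1 : ℂ)) by
    rw [← map_natCast C]; push_cast; ring_nf] at h3
  apply C_mul_cancel ha
  rw [map_sub, twistedDeriv_pow_C_mul, map_sub, restrict_C_mul, mul_sub, h1, mul_zero]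
  rcases Nat.lt_or_ge (s + 1) m with h | h
  · have h4 : restrict a ((twistedDeriv a ^ (2 * s + 1 + 2)) f) = 0 := hf (s + 1) h
    rw [h4, ← mul_assoc, ← C_mul] at h3
    have h5 : restrict a ((twistedDeriv a ^ (2 * s + 1)) q) = 0 := by
      refine C_mul_cancel (c := 2 * (s + 1 : ℂ) * a ⬝ᵥ a) ?_ (by rw [h3, mul_zero])
      exact mul_ne_zero (mul_ne_zero two_ne_zero (by exact_mod_cast s.succ_ne_zero)) ha
    rw [h4, h5]; simp
  · have : (m : ℂ) = s + 1 := by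
      have : m = s + 1 := by omega
      rw [this]; push_cast; ring
    rw [this, ← h3]; ring

/-- The recursion for normal derivatives trades one derivative of `q i` for one factor cot, keeping
the parity of k + e. Each remaining term is a product of a cotangent sum and a normal derivative of
f (possibly differentiated tangentially), and parity makes one of the two zero. The case needed
later is e = 0; general e makes the induction work. -/
lemma sum_restrict_quotient {ι : Type*} {a : Fin 2 → ℂ} (ha : a ⬝ᵥ a ≠ 0) (S : Finset ι)
    (α : ι → Fin 2 → ℂ) (w : ι → ℂ) (q : ι → PlanePoly) {f : PlanePoly} {m : ℕ}
    (hα : ∀ i ∈ S, rot a ⬝ᵥ α i ≠ 0)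
    (hodd : ∀ s < m, ∑ i ∈ S, w i * cotAngle a (α i) ^ (2 * s + 1) = 0)
    (hf : ∀ s < m, restrict a ((twistedDeriv a ^ (2 * s + 1)) f) = 0)
    (hq : ∀ i ∈ S, w i ≠ 0 → linForm Sum.inr (α i) * q i = twistedDeriv (α i) f) (k : ℕ) :
    ∀ e, k + e < 2 * m → Odd (k + e) →
      ∑ i ∈ S, C (w i * cotAngle a (α i) ^ e) * restrict a ((twistedDeriv a ^ k) (q i)) = 0 := by
  have hcot : ∀ i ∈ S, a ⬝ᵥ α i = (rot a ⬝ᵥ α i) * cotAngle a (α i) := fun i hi => by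
    rw [cotAngle, mul_div_cancel₀ _ (hα i hi)]
  have hodd' : ∀ e, e < 2 * m → Odd e → ∑ i ∈ S, C (σ := Fin 2 ⊕ Fin 2) (w i * cotAngle a (α i) ^
      e) = 0 := by
    rintro e he ⟨s, rfl⟩
    rw [← map_sum, hodd s (by omega), C_0]
  have hfodd : ∀ e, e < 2 * m → Odd e → restrict a ((twistedDeriv a ^ e) f) = 0 := by
    rintro e he ⟨s, rfl⟩
    exact hf s (by omega)
  have hy := linForm_ne_zero (a := rot a) (by rwa [rot_dotProduct_rot])
  induction k with
  | zero =>
    intro e he ho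
    rw [zero_add] at he ho
    refine (mul_eq_zero.1 ?_).resolve_left hy
    have hp : restrict a (twistedDeriv a f) = 0 := by
      simpa using hfodd 1 (by obtain ⟨s, rfl⟩ := ho; omega) odd_one
    have : ∀ i ∈ S, linForm Sum.inr (rot a) * (C (w i * cotAngle a (α i) ^ e) * restrict a (q i)) =
        C (w i * cotAngle a (α i) ^ e) * restrict a (twistedDeriv (rot a) f) := by
      intro i hi
      by_cases hw : w i = 0
      · simp [hw]
      · have h := restrict_quotient (hq i hi hw) ha
        rw [hp, mul_zero, zero_add] at h
        rw [← C_mul_cancel (hα i hi) h]; ring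
    simp only [pow_zero, Module.End.one_apply]
    rw [Finset.mul_sum, Finset.sum_congr rfl this, ← Finset.sum_mul, hodd' e he ho, zero_mul]
  | succ k ih =>
    intro e he ho
    refine (mul_eq_zero.1 ?_).resolve_left hy
    have : ∀ i ∈ S, linForm Sum.inr (rot a) *
        (C (w i * cotAngle a (α i) ^ e) * restrict a ((twistedDeriv a ^ (k + 1)) (q i))) =
        C (w i * cotAngle a (α i) ^ (e + 1)) * restrict a ((twistedDeriv a ^ (k + 2)) f) +
        C (w i * cotAngle a (α i) ^ e) *
          restrict a (twistedDeriv (rot a) ((twistedDeriv a ^ (k + 1)) f)) -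
        C (a ⬝ᵥ a) * ((k + 1 : ℕ) : PlanePoly) * (C (w i * cotAngle a (α i) ^ (e + 1)) *
          restrict a ((twistedDeriv a ^ k) (q i))) := by
      intro i hi
      by_cases hw : w i = 0
      · simp [hw]
      · have h := restrict_twistedDeriv_pow_quotient (hq i hi hw) ha k
        rw [hcot i hi, C_mul] at h
        have h' : linForm Sum.inr (rot a) * restrict a ((twistedDeriv a ^ (k + 1)) (q i)) =
            C (cotAngle a (α i)) * restrict a ((twistedDeriv a ^ (k + 2)) f) +
              restrict a (twistedDeriv (rot a) ((twistedDeriv a ^ (k + 1)) f)) -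
            C (a ⬝ᵥ a) * ((k + 1 : ℕ) : PlanePoly) *
              (C (cotAngle a (α i)) * restrict a ((twistedDeriv a ^ k) (q i))) := by
          apply C_mul_cancel (hα i hi)
          linear_combination h
        rw [mul_left_comm, h', pow_succ (cotAngle a (α i)) e, ← mul_assoc (w i),
            C_mul (a := w i * cotAngle a (α i) ^ e)]
        ring
    rw [Finset.mul_sum, Finset.sum_congr rfl this, Finset.sum_sub_distrib, Finset.sum_add_distrib,
      ← Finset.mul_sum, ih (e + 1) (by omega) (by rwa [add_assoc, add_comm 1 e] at ho),
      ← Finset.sum_mul, ← Finset.sum_mul]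
    rcases Nat.even_or_odd e with h | h
    · have hk : Odd (k + 1) := by
        rcases Nat.even_or_odd (k + 1) with h' | h'
        · exact absurd ho (Nat.not_odd_iff_even.2 (h'.add h))
        · exact h'
      rw [hodd' (e + 1) (by omega) h.add_one, restrict_twistedDeriv_rot ha (hfodd (k + 1) (by
          omega) hk)]
      simp
    · have hk : Odd (k + 2) := by
        rcases Nat.even_or_odd (k + 1) with h' | h'
        · exact h'.add_one
        · exact absurd ho (Nat.not_odd_iff_even.2 (h'.add_odd h))
      -- Gives k + 2 ≤ k + 1 + e < 2m, so the derivative of order k + 2 is still covered by the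
      -- hypothesis on f.
      have : 1 ≤ e := h.pos
      rw [hodd' e (by omega) h, hfodd (k + 2) (by omega) hk]
      simp

/-! ### Locus configurations and quasi-invariants -/

section Configuration

variable {ι : Type*} [Fintype ι] [DecidableEq ι]

/-- Pairwise non-collinear non-isotropic vectors with multiplicities, which satisfy
`∑_{i ≠ j} mᵢ cot^{2s+1} ∠(αⱼ, αᵢ) = 0` for `s < mⱼ`. -/
structure IsLocus (α : ι → Fin 2 → ℂ) (m : ι → ℕ) : Prop where
  norm_ne : ∀ j, α j ⬝ᵥ α j ≠ 0
  indep : ∀ i j, i ≠ j → rot (α j) ⬝ᵥ α i ≠ 0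
  cot_sum : ∀ j, ∀ s < m j,
    ∑ i ∈ Finset.univ.erase j, (m i : ℂ) * cotAngle (α j) (α i) ^ (2 * s + 1) = 0

/-- `f e^{(λ, x)}` satisfies the vanishing conditions of a Baker-Akhiezer function. -/
def QuasiInvariant (α : ι → Fin 2 → ℂ) (m : ι → ℕ) (f : PlanePoly) : Prop :=
  ∀ j, ∀ s < m j, linForm Sum.inr (α j) ∣ (twistedDeriv (α j) ^ (2 * s + 1)) f

/-- The gauged Calogero-Moser operator preserves quasi-invariance. -/
theorem IsLocus.quasiInvariant {α : ι → Fin 2 → ℂ} {m : ι → ℕ} (h : IsLocus α m) {f : PlanePoly}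
    (hf : QuasiInvariant α m f) {q : ι → PlanePoly}
    (hq : ∀ i, m i ≠ 0 → linForm Sum.inr (α i) * q i = twistedDeriv (α i) f) :
    QuasiInvariant α m (twistedLapl f - ∑ i, C (2 * (m i : ℂ)) * q i) := by
  intro j s hs
  have ha := h.norm_ne j
  have hf' : ∀ s < m j, restrict (α j) ((twistedDeriv (α j) ^ (2 * s + 1)) f) = 0 :=
    fun s hs => (linForm_dvd_iff ha _).1 (hf j s hs)
  rw [linForm_dvd_iff ha, ← Finset.add_sum_erase _ _ (Finset.mem_univ j), ← sub_sub, map_sub,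
    map_sub (restrict (α j)), restrict_twistedLapl_sub ha hf' (hq j (by omega)) hs, zero_sub,
        neg_eq_zero]
  have := sum_restrict_quotient ha (Finset.univ.erase j) α (fun i => (m i : ℂ)) q
    (fun i hi => h.indep i j (Finset.ne_of_mem_erase hi)) (h.cot_sum j) hf'
    (fun i _ hi => hq i (by simpa using hi)) (2 * s + 1) 0 (by omega) (by simp)
  simp only [pow_zero, mul_one] at this
  have h2 : ∀ i, C (σ := Fin 2 ⊕ Fin 2) (2 * (m i : ℂ)) = C 2 * C (m i : ℂ) := fun i => C_mul
  simp only [map_sum, twistedDeriv_pow_C_mul, restrict_C_mul, h2, mul_assoc]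
  rw [← Finset.mul_sum, this, mul_zero]

end Configuration

/-! ### Homogeneous components in (λ, x) and the derivation (λ, ∂/∂x) -/

lemma homogeneousComponent_mul_left {σ R : Type*} [CommSemiring R] {u : MvPolynomial σ R}
    (hu : u.IsHomogeneous 1) (k : ℕ) (f : MvPolynomial σ R) :
    homogeneousComponent (k + 1) (u * f) = u * homogeneousComponent k f := by
  induction f using MvPolynomial.induction_on' with
  | monomial d c =>
    have hd := isHomogeneous_monomial c (rfl : d.degree = d.degree)
    have h := hu.mul hd
    rw [add_comm] at h
    rw [homogeneousComponent_of_mem h, homogeneousComponent_of_mem hd]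
    simp
  | add p q hp hq => rw [mul_add, map_add, map_add, hp, hq, mul_add]

lemma homogeneousComponent_pderiv {σ R : Type*} [CommSemiring R] (i : σ) (k : ℕ)
    (f : MvPolynomial σ R) :
    homogeneousComponent k (pderiv i f) = pderiv i (homogeneousComponent (k + 1) f) := by
  induction f using MvPolynomial.induction_on' with
  | monomial d c =>
    have hd := isHomogeneous_monomial c (rfl : d.degree = d.degree)
    rw [homogeneousComponent_of_mem hd]
    rcases h0 : d.degree with _ | n
    · have : d = 0 := by rwa [Finsupp.degree_eq_zero_iff] at h0
      subst this
      simp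
    · rw [h0] at hd
      rw [homogeneousComponent_of_mem (hd.pderiv (i := i))]
      simp only [add_tsub_cancel_right, add_left_inj]
      split_ifs <;> simp
  | add p q hp hq => simp only [map_add, hp, hq]

lemma linForm_isHomogeneous {N : ℕ} {σ : Type*} (v : Fin N → σ) (a : Fin N → ℂ) :
    (linForm v a).IsHomogeneous 1 :=
  IsHomogeneous.sum _ _ _ fun i _ => by
    simpa using (isHomogeneous_C σ (a i)).mul (isHomogeneous_X ℂ (v i))

lemma homogeneousComponent_lamDeriv (k : ℕ) (f : PlanePoly) :
    homogeneousComponent k (lamDeriv f) = lamDeriv (homogeneousComponent k f) := by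
  rcases k with _ | k
  · rw [lamDeriv_apply, lamDeriv_apply, homogeneousComponent_zero, homogeneousComponent_zero]
    simp [coeff_X_mul']
  · rw [lamDeriv_apply, map_add, homogeneousComponent_mul_left (isHomogeneous_X ..),
      homogeneousComponent_mul_left (isHomogeneous_X ..), homogeneousComponent_pderiv,
      homogeneousComponent_pderiv, lamDeriv_apply]

/-- Δ lowers the total degree by two while (λ, ∂/∂x) preserves it, so Δ could contribute only from
degree k + 2. -/
lemma homogeneousComponent_twistedLapl {k : ℕ} {f : PlanePoly}
    (h : homogeneousComponent (k + 2) f = 0) :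
    homogeneousComponent k (twistedLapl f) = 2 * lamDeriv (homogeneousComponent k f) := by
  have h2 : (2 : PlanePoly) = C 2 := (map_ofNat C 2).symm
  rw [twistedLapl, lapl, map_add, map_add, homogeneousComponent_pderiv, homogeneousComponent_pderiv,
    homogeneousComponent_pderiv, homogeneousComponent_pderiv, h, h2, homogeneousComponent_C_mul,
    homogeneousComponent_lamDeriv]
  simp

lemma homogeneousComponent_twistedDeriv {k : ℕ} {f : PlanePoly} (a : Fin 2 → ℂ)
    (h : homogeneousComponent (k + 2) f = 0) :
    homogeneousComponent (k + 1) (twistedDeriv a f) =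
      linForm Sum.inl a * homogeneousComponent k f := by
  simp only [twistedDeriv_apply, twistedPartial_apply, map_add, homogeneousComponent_C_mul,
    homogeneousComponent_pderiv, h, map_zero, zero_add, linForm_two,
    homogeneousComponent_mul_left (isHomogeneous_X ..)]
  ring

lemma derivation_prod {A ι : Type*} [CommRing A] [Algebra ℂ A] [DecidableEq ι]
    (d : Derivation ℂ A A) (f : ι → A) (S : Finset ι) :
    d (∏ i ∈ S, f i) = ∑ i ∈ S, (∏ j ∈ S.erase i, f j) * d (f i) := by
  induction S using Finset.induction_on with
  | empty => simp
  | insert a S ha ih =>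
    rw [Finset.prod_insert ha, Derivation.leibniz, ih, Finset.sum_insert ha,
      Finset.erase_insert ha, smul_eq_mul, smul_eq_mul, Finset.mul_sum, add_comm]
    congr 1
    refine Finset.sum_congr rfl fun i hi => ?_
    have hne : a ≠ i := fun h => ha (h ▸ hi)
    rw [Finset.erase_insert_of_ne hne, Finset.prod_insert (fun h => ha (Finset.mem_of_mem_erase h)),
      mul_assoc]

lemma lamDeriv_linForm_inr (a : Fin 2 → ℂ) :
    lamDeriv (linForm Sum.inr a) = linForm Sum.inl a := by
  simp only [lamDeriv_apply, linForm_two, map_add, pderiv_mul, pderiv_C, pderiv_X]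
  simp
  ring

lemma lamDeriv_linForm_inl (a : Fin 2 → ℂ) : lamDeriv (linForm Sum.inl a) = 0 := by
  simp only [lamDeriv_apply, linForm_two, map_add, pderiv_mul, pderiv_C, pderiv_X]
  simp

/-- If `d x = y` and `d y = 0`, then `d^n` maps the product of `n` factors `x` to `n!` times the
product of the factors `y`. -/
lemma iterate_derivation_mul {A : Type*} [CommRing A] [Algebra ℂ A] {d : Derivation ℂ A A}
    {x y f g : A} {n : ℕ} (hx : d x = y) (hy : d y = 0) (hf : d g = 0)
    (h : ((d : A →ₗ[ℂ] A) ^ n : Module.End ℂ A) f = n.factorial * g) :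
    d (y * g) = 0 ∧
      ((d : A →ₗ[ℂ] A) ^ (n + 1) : Module.End ℂ A) (x * f) = (n + 1).factorial * (y * g) := by
  have hu : ∀ g, (d : A →ₗ[ℂ] A) (x * g) = y * g + x * (d : A →ₗ[ℂ] A) g := fun g => by
    simp [hx]; ring
  have hw : ∀ g, (d : A →ₗ[ℂ] A) (y * g) = y * (d : A →ₗ[ℂ] A) g := fun g => by simp [hy]
  refine ⟨by simp [hy, hf], ?_⟩
  rw [pow_succ_apply_mul (T := (d : A →ₗ[ℂ] A)) hu hw, pow_succ', Module.End.mul_apply, h,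
      Nat.factorial_succ]
  simp [hf]
  ring

/-! ### Iterating the operator on the square of ∏ (αᵢ, x)^{mᵢ} -/

section

variable {ι : Type*}

/-- The polynomial `∏ᵢ (αᵢ, x)^{mᵢ}`. -/
def xProd (α : ι → Fin 2 → ℂ) (m : ι → ℕ) (S : Finset ι) : PlanePoly :=
  ∏ i ∈ S, linForm Sum.inr (α i) ^ m i

/-- The polynomial `∏ᵢ (αᵢ, λ)^{mᵢ}`. -/
def lamProd (α : ι → Fin 2 → ℂ) (m : ι → ℕ) (S : Finset ι) : PlanePoly :=
  ∏ i ∈ S, linForm Sum.inl (α i) ^ m i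

/-- (λ, ∂/∂x) turns (α, x) into (α, λ) and kills (α, λ). Applied as often as there are factors, it
must hit each factor exactly once, in any order; hence the factorial. -/
lemma lamDeriv_pow_xProd (α : ι → Fin 2 → ℂ) (m : ι → ℕ) (S : Finset ι) :
    lamDeriv (lamProd α m S) = 0 ∧
    ((lamDeriv : PlanePoly →ₗ[ℂ] PlanePoly) ^ (∑ i ∈ S, m i) : Module.End ℂ PlanePoly) (xProd α m S)
      = ((∑ i ∈ S, m i).factorial : PlanePoly) * lamProd α m S := by
  classical
  induction S using Finset.induction_on with
  | empty => simp [xProd, lamProd]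
  | insert a S ha ih =>
    have key : ∀ k : ℕ, lamDeriv (linForm Sum.inl (α a) ^ k * lamProd α m S) = 0 ∧
        ((lamDeriv : PlanePoly →ₗ[ℂ] PlanePoly) ^ (k + ∑ i ∈ S, m i) : Module.End ℂ PlanePoly)
          (linForm Sum.inr (α a) ^ k * xProd α m S) =
        ((k + ∑ i ∈ S, m i).factorial : PlanePoly) * (linForm Sum.inl (α a) ^ k * lamProd α m S) :=
            by
      intro k
      induction k with
      | zero => simpa using ih
      | succ k ihk =>
        have := iterate_derivation_mul (lamDeriv_linForm_inr (α a)) (lamDeriv_linForm_inl (α a))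
          ihk.1 ihk.2
        simpa only [pow_succ', mul_assoc, add_right_comm k _ 1] using this
    simpa [xProd, lamProd, Finset.sum_insert ha, Finset.prod_insert ha] using key (m a)


variable [Fintype ι]

/-- The logarithmic derivative of A = ∏ (αᵢ, x)^{mᵢ} without denominators: `B i` plays the role of
A/(αᵢ, x). -/
lemma lamDeriv_xProd [DecidableEq ι] (α : ι → Fin 2 → ℂ) (m : ι → ℕ) :
    ∃ B : ι → PlanePoly, (∀ i, m i ≠ 0 → linForm Sum.inr (α i) * B i = xProd α m Finset.univ) ∧
      lamDeriv (xProd α m Finset.univ) = ∑ i, C (m i : ℂ) * (linForm Sum.inl (α i) * B i) := by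
  refine ⟨fun i => (∏ j ∈ Finset.univ.erase i, linForm Sum.inr (α j) ^ m j) *
    linForm Sum.inr (α i) ^ (m i - 1), fun i hi => ?_, ?_⟩
  · rw [mul_left_comm, ← pow_succ', Nat.sub_add_cancel (Nat.pos_of_ne_zero hi), xProd,
      Finset.prod_erase_mul _ _ (Finset.mem_univ i)]
  · rw [xProd, derivation_prod]
    refine Finset.sum_congr rfl fun i _ => ?_
    rw [Derivation.leibniz_pow, lamDeriv_linForm_inr, nsmul_eq_mul, smul_eq_mul, map_natCast]
    ring

/-- One step of the construction: the gauged Calogero-Moser operator, applied to a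
quasi-invariant with top component `∏ᵢ (αᵢ, x)^{mᵢ} g`. -/
lemma IsLocus.exists_step [DecidableEq ι] {α : ι → Fin 2 → ℂ} {m : ι → ℕ} (h : IsLocus α m) {d : ℕ}
    {f g : PlanePoly} (hf : QuasiInvariant α m f)
    (hd : ∀ k, d < k → homogeneousComponent k f = 0)
    (hg : homogeneousComponent d f = xProd α m Finset.univ * g) :
    ∃ f', QuasiInvariant α m f' ∧ (∀ k, d < k → homogeneousComponent k f' = 0) ∧
      homogeneousComponent d f' = C 2 * (xProd α m Finset.univ * lamDeriv g) := by
  have hex : ∀ i, ∃ q, m i ≠ 0 → linForm Sum.inr (α i) * q = twistedDeriv (α i) f := by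
    intro i
    by_cases hi : m i = 0
    -- With multiplicity zero there is no divisibility, but the term has coefficient zero and any q
    -- will do.
    · exact ⟨0, fun h => absurd hi h⟩
    · obtain ⟨q, hq⟩ := hf i 0 (Nat.pos_of_ne_zero hi)
      exact ⟨q, fun _ => by rw [← hq]; simp⟩
  choose q hq using hex
  obtain ⟨B, hB, hA⟩ := lamDeriv_xProd α m
  have hqk : ∀ k, d ≤ k → ∀ i, m i ≠ 0 → linForm Sum.inr (α i) * homogeneousComponent k (q i) =
      linForm Sum.inl (α i) * homogeneousComponent k f := by
    intro k hk i hi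
    rw [← homogeneousComponent_mul_left (linForm_isHomogeneous _ _), hq i hi,
      homogeneousComponent_twistedDeriv _ (hd _ (by omega))]
  refine ⟨_, h.quasiInvariant hf hq, fun k hk => ?_, ?_⟩
  · rw [map_sub, homogeneousComponent_twistedLapl (hd _ (by omega)), hd k hk, map_sum,
      Finset.sum_eq_zero, map_zero, mul_zero, sub_zero]
    intro i _
    by_cases hi : m i = 0
    · simp [hi]
    · have := hqk k hk.le i hi
      rw [hd k hk, mul_zero] at this
      rw [homogeneousComponent_C_mul, (mul_eq_zero.1 this).resolve_left
        (linForm_ne_zero (h.norm_ne i)), mul_zero]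
  -- The singular terms contribute 2g (λ, ∂/∂x)A in degree d, exactly the part of 2(λ, ∂/∂x)(A g) in
  -- which A is differentiated.
  · have hsum : ∀ i, homogeneousComponent d (C (2 * (m i : ℂ)) * q i) =
        C 2 * g * (C (m i : ℂ) * (linForm Sum.inl (α i) * B i)) := by
      intro i
      by_cases hi : m i = 0
      · simp [hi]
      · have : homogeneousComponent d (q i) = linForm Sum.inl (α i) * (B i * g) := by
          apply mul_left_cancel₀ (linForm_ne_zero (h.norm_ne i))
          rw [hqk d le_rfl i hi, hg, ← hB i hi]
          ring
        rw [homogeneousComponent_C_mul, this, C_mul]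
        ring
    rw [map_sub, homogeneousComponent_twistedLapl (hd _ (by omega)), hg, map_sum,
      Finset.sum_congr rfl fun i _ => hsum i, ← Finset.mul_sum, ← hA, Derivation.leibniz]
    have h2 : (2 : PlanePoly) = C 2 := (map_ofNat C 2).symm
    simp only [smul_eq_mul, h2]
    ring

lemma IsLocus.exists_iterate [DecidableEq ι] {α : ι → Fin 2 → ℂ} {m : ι → ℕ} (h : IsLocus α m) {d :
    ℕ}
    {f g : PlanePoly} (hf : QuasiInvariant α m f)
    (hd : ∀ k, d < k → homogeneousComponent k f = 0)
    (hg : homogeneousComponent d f = xProd α m Finset.univ * g) (n : ℕ) :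
    ∃ f', QuasiInvariant α m f' ∧ (∀ k, d < k → homogeneousComponent k f' = 0) ∧
      homogeneousComponent d f' = xProd α m Finset.univ *
        (C (2 ^ n) * ((lamDeriv : PlanePoly →ₗ[ℂ] PlanePoly) ^ n : Module.End ℂ PlanePoly) g) := by
  induction n with
  | zero => exact ⟨f, hf, hd, by simp [hg]⟩
  | succ n ih =>
    obtain ⟨f', h1, h2, h3⟩ := ih
    obtain ⟨f'', h4, h5, h6⟩ := h.exists_step h1 h2 h3
    refine ⟨f'', h4, h5, ?_⟩
    rw [h6, ← smul_eq_C_mul (_ : PlanePoly) (2 ^ n), Derivation.map_smul,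
        pow_succ' (lamDeriv : PlanePoly →ₗ[ℂ] PlanePoly), Module.End.mul_apply,
      smul_eq_C_mul, pow_succ' (2 : ℂ), C_mul (a := 2)]
    simp only [Derivation.coeFn_coe]
    ring

/-- Each derivative lowers the order of vanishing on a line by at most one. -/
lemma linForm_pow_dvd_twistedDeriv (a c : Fin 2 → ℂ) (k n : ℕ) {f : PlanePoly}
    (h : linForm Sum.inr c ^ (n + k) ∣ f) :
    linForm Sum.inr c ^ n ∣ (twistedDeriv a ^ k) f := by
  induction k generalizing f with
  | zero => simpa using h
  | succ k ih =>
    rw [pow_succ, Module.End.mul_apply]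
    apply ih
    clear ih
    rw [← add_assoc] at h
    generalize n + k = l at h ⊢
    obtain ⟨g, rfl⟩ := h
    clear n k
    induction l with
    | zero => simp
    | succ l ih =>
      rw [pow_succ' _ (l + 1), mul_assoc, twistedDeriv_linForm_mul]
      have h : linForm Sum.inr c ^ (l + 1) ∣
          linForm Sum.inr c * twistedDeriv a (linForm Sum.inr c ^ (l + 1) * g) := by
        obtain ⟨r, hr⟩ := ih
        exact ⟨r, by rw [hr, pow_succ', mul_assoc]⟩
      exact dvd_add ((dvd_mul_right _ g).mul_left _) h

lemma quasiInvariant_xProd_sq (α : ι → Fin 2 → ℂ) (m : ι → ℕ) :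
    QuasiInvariant α m (xProd α m Finset.univ * xProd α m Finset.univ) := by
  intro j s hs
  have h1 : linForm Sum.inr (α j) ^ m j ∣ xProd α m Finset.univ :=
    Finset.dvd_prod_of_mem (fun i => linForm Sum.inr (α i) ^ m i) (Finset.mem_univ j)
  have h2 := mul_dvd_mul h1 h1
  rw [← pow_add] at h2
  have h3 : linForm Sum.inr (α j) ^ (1 + (2 * s + 1)) ∣ xProd α m Finset.univ * xProd α m
      Finset.univ :=
    (pow_dvd_pow _ (by omega)).trans h2
  simpa using linForm_pow_dvd_twistedDeriv (α j) (α j) (2 * s + 1) 1 h3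

lemma xProd_isHomogeneous (α : ι → Fin 2 → ℂ) (m : ι → ℕ) :
    (xProd α m Finset.univ).IsHomogeneous (∑ i, m i) :=
  IsHomogeneous.prod _ _ _ fun i _ => by
    simpa using (linForm_isHomogeneous Sum.inr (α i)).pow (m i)

lemma IsLocus.exists_poly [DecidableEq ι] {α : ι → Fin 2 → ℂ} {m : ι → ℕ} (h : IsLocus α m) :
    ∃ P, QuasiInvariant α m P ∧ (∀ k, 2 * ∑ i, m i < k → homogeneousComponent k P = 0) ∧
      homogeneousComponent (2 * ∑ i, m i) P = leadingTerm α m := by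
  have hA := xProd_isHomogeneous α m
  have hAA := hA.mul hA
  rw [← two_mul] at hAA
  obtain ⟨f, h1, h2, h3⟩ := h.exists_iterate (quasiInvariant_xProd_sq α m)
    (fun k hk => by rw [homogeneousComponent_of_mem hAA, if_neg hk.ne'])
    (homogeneousComponent_eq_self hAA) (∑ i, m i)
  rw [(lamDeriv_pow_xProd α m Finset.univ).2, ← map_natCast C, ← mul_assoc (C _), ← C_mul] at h3
  set c : ℂ := 2 ^ (∑ i, m i) * ((∑ i, m i).factorial : ℕ) with hc
  have hc0 : c ≠ 0 := mul_ne_zero (pow_ne_zero _ two_ne_zero)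
    (Nat.cast_ne_zero.2 (Nat.factorial_ne_zero _))
  refine ⟨C c⁻¹ * f, fun j s hs => ?_, fun k hk => ?_, ?_⟩
  · rw [twistedDeriv_pow_C_mul]
    exact (h1 j s hs).mul_left _
  · rw [homogeneousComponent_C_mul, h2 k hk, mul_zero]
  · rw [homogeneousComponent_C_mul, h3, mul_left_comm, ← mul_assoc (C c⁻¹), ← C_mul,
      inv_mul_cancel₀ hc0, C_1, one_mul, leadingTerm, Finset.prod_mul_distrib, mul_comm]
    rfl

end

/-! ### From polynomials to functions P e^{(λ, x)} -/

lemma hasLineDerivAt_eval (a l x : Fin 2 → ℂ) (P : PlanePoly) :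
    HasLineDerivAt ℂ (fun x => eval (Sum.elim l x) P)
      (eval (Sum.elim l x) (C (a 0) * pderiv (Sum.inr 0) P + C (a 1) * pderiv (Sum.inr 1) P)) x a
          := by
  unfold HasLineDerivAt
  induction P using MvPolynomial.induction_on with
  | C c => simpa using hasDerivAt_const (0 : ℂ) c
  | add p q hp hq =>
    convert hp.add hq using 1
    · ext t; simp
    · simp; ring
  | mul_X p k hp =>
    have hk : HasDerivAt (fun t : ℂ => Sum.elim l (x + t • a) k) (Sum.elim 0 a k) 0 := by
      rcases k with k | k
      · simpa using hasDerivAt_const (0 : ℂ) (l k)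
      · simpa using ((hasDerivAt_id (0 : ℂ)).mul_const (a k)).const_add (x k)
    simp only [map_mul, eval_X]
    refine (hp.mul hk).congr_deriv ?_
    rcases k with k | k
    · simp; ring
    · fin_cases k <;> simp [pderiv_X] <;> ring

lemma dirDeriv_eval_mul_exp (a l : Fin 2 → ℂ) (P : PlanePoly) :
    dirDeriv a (fun x => eval (Sum.elim l x) P * Complex.exp (l ⬝ᵥ x)) =
      fun x => eval (Sum.elim l x) (twistedDeriv a P) * Complex.exp (l ⬝ᵥ x) := by
  ext x
  have h2 : HasDerivAt (fun t : ℂ => l ⬝ᵥ (x + t • a)) (l ⬝ᵥ a) 0 := by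
    simp only [dotProduct_add, dotProduct_smul, smul_eq_mul]
    simpa using ((hasDerivAt_id (0 : ℂ)).mul_const (l ⬝ᵥ a)).const_add (l ⬝ᵥ x)
  have h1 := hasLineDerivAt_eval a l x P
  unfold HasLineDerivAt at h1
  have h : HasLineDerivAt ℂ (fun x => eval (Sum.elim l x) P * Complex.exp (l ⬝ᵥ x)) _ x a :=
    HasDerivAt.mul h1 h2.cexp
  refine h.lineDeriv.trans ?_
  simp only [zero_smul, add_zero, twistedDeriv_apply, twistedPartial_apply, map_add, map_mul,
    eval_C, eval_X, Sum.elim_inl, dotProduct_two]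
  ring

lemma iterate_dirDeriv (a l : Fin 2 → ℂ) (P : PlanePoly) (k : ℕ) :
    (dirDeriv a)^[k] (fun x => eval (Sum.elim l x) P * Complex.exp (l ⬝ᵥ x)) =
      fun x => eval (Sum.elim l x) ((twistedDeriv a ^ k) P) * Complex.exp (l ⬝ᵥ x) := by
  induction k with
  | zero => rfl
  | succ k ih =>
    rw [Function.iterate_succ_apply', ih, dirDeriv_eval_mul_exp, pow_succ', Module.End.mul_apply]

/-- A planar locus configuration admits a Baker-Akhiezer function. -/
theorem IsLocus.exists_isBAFunction {ι : Type*} [Fintype ι] [DecidableEq ι] {α : ι → Fin 2 → ℂ}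
    {m : ι → ℕ} (h : IsLocus α m) : ∃ φ, IsBAFunction α m φ := by
  obtain ⟨P, h1, h2, h3⟩ := h.exists_poly
  refine ⟨fun l x => eval (Sum.elim l x) P * Complex.exp (l ⬝ᵥ x), ⟨P, ?_, h3, fun _ _ => rfl⟩, ?_⟩
  · by_contra hlt
    push Not at hlt
    refine hlt.not_ge (Finset.sup_le fun d hd => ?_)
    by_contra hdlt
    push Not at hdlt
    have := congrArg (coeff d) (h2 _ hdlt)
    rw [coeff_homogeneousComponent, if_pos (show d.degree = d.sum fun _ e => e from rfl),
        coeff_zero] at this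
    exact mem_support_iff.1 hd this
  · intro i s hs hsm l x hx
    obtain ⟨g, hg⟩ := h1 i (s - 1) (by omega)
    rw [iterate_dirDeriv, show 2 * s - 1 = 2 * (s - 1) + 1 by omega, hg]
    have : eval (Sum.elim l x) (linForm Sum.inr (α i)) = 0 := by
      rw [← hx, dotProduct_two]
      simp [linForm_two]
    simp only [map_mul, this, zero_mul]

/-! ### Real vectors, the coordinates zᵢ and cotangents -/

lemma complexify_dotProduct {ι : Type*} (α : ι → EuclideanSpace ℝ (Fin 2)) (i j : ι) :
    complexify α i ⬝ᵥ complexify α j = ((α i 0 * α j 0 + α i 1 * α j 1 : ℝ) : ℂ) := by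
  simp [complexify]

lemma rot_complexify_dotProduct {ι : Type*} (α : ι → EuclideanSpace ℝ (Fin 2)) (i j : ι) :
    rot (complexify α i) ⬝ᵥ complexify α j = ((α i 0 * α j 1 - α i 1 * α j 0 : ℝ) : ℂ) := by
  simp [complexify]
  ring

lemma linearIndependent_pair_iff_det (v w : EuclideanSpace ℝ (Fin 2)) :
    LinearIndependent ℝ ![v, w] ↔ v 0 * w 1 - v 1 * w 0 ≠ 0 := by
  rw [LinearIndependent.pair_iff]
  constructor
  · intro h h0
    obtain ⟨h1, h2⟩ := h (w 0) (-v 0) (by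
      ext k; fin_cases k
      · simp; ring
      · simp; linarith)
    obtain ⟨h3, h4⟩ := h (w 1) (-v 1) (by
      ext k; fin_cases k
      · simp; linarith
      · simp; ring)
    have := h 1 0 (by
      ext k; fin_cases k
      · simp; linarith
      · simp; linarith)
    exact one_ne_zero this.1
  · intro h s t hst
    have e0 := congrArg (fun u : EuclideanSpace ℝ (Fin 2) => u 0) hst
    have e1 := congrArg (fun u : EuclideanSpace ℝ (Fin 2) => u 1) hst
    simp at e0 e1
    constructor
    · refine (mul_eq_zero.1 ?_).resolve_right h
      linear_combination w 1 * e0 - w 0 * e1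
    · refine (mul_eq_zero.1 ?_).resolve_right h
      linear_combination v 0 * e1 - v 1 * e0

/-- With w = v₀ + i v₁ this is e^{2i arg w} = w / w̄, which makes z rational in the coordinates. -/
lemma zCoord_mul_conj {v : EuclideanSpace ℝ (Fin 2)} (hv : (⟨v 0, v 1⟩ : ℂ) ≠ 0) :
    zCoord v * (v 0 - v 1 * Complex.I) = v 0 + v 1 * Complex.I := by
  set w : ℂ := ⟨v 0, v 1⟩ with hw
  have h1 : (v 0 : ℂ) + v 1 * Complex.I = w := (Complex.mk_eq_add_mul_I _ _).symm
  have h3 := Complex.norm_mul_exp_arg_mul_I w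
  have h4 : zCoord v = Complex.exp (w.arg * Complex.I) ^ 2 := by
    rw [← Complex.exp_nat_mul, zCoord]
    congr 1
    push_cast
    ring
  have h5 : w * ((v 0 : ℂ) - v 1 * Complex.I) = (‖w‖ : ℂ) ^ 2 := by
    rw [← Complex.mul_conj', ← h1]
    simp
    left; ring
  apply mul_left_cancel₀ hv
  rw [h1, mul_left_comm, h5, h4]
  linear_combination (‖w‖ * Complex.exp (w.arg * Complex.I) + w) * h3

lemma zCoord_ratio {ι : Type*} (α : ι → EuclideanSpace ℝ (Fin 2)) (i j : ι)
    (h : α j 0 * α i 1 - α j 1 * α i 0 ≠ 0) :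
    (zCoord (α i) + zCoord (α j)) / (zCoord (α i) - zCoord (α j)) =
      -Complex.I * cotAngle (complexify α j) (complexify α i) := by
  have hi : (⟨α i 0, α i 1⟩ : ℂ) ≠ 0 := by
    intro h0
    rw [Complex.ext_iff] at h0
    simp at h0
    simp [h0] at h
  have hj : (⟨α j 0, α j 1⟩ : ℂ) ≠ 0 := by
    intro h0
    rw [Complex.ext_iff] at h0
    simp at h0
    simp [h0] at h
  have ei := zCoord_mul_conj hi
  have ej := zCoord_mul_conj hj
  have hI : ∀ v : EuclideanSpace ℝ (Fin 2), (⟨v 0, v 1⟩ : ℂ) ≠ 0 →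
      (v 0 - v 1 * Complex.I : ℂ) ≠ 0 := by
    intro v hv h0
    apply hv
    rw [Complex.ext_iff] at h0 ⊢
    simpa using h0
  have ci := hI _ hi
  have cj := hI _ hj
  rw [← eq_div_iff ci] at ei
  rw [← eq_div_iff cj] at ej
  have hne : ((α j 0 * α i 1 - α j 1 * α i 0 : ℝ) : ℂ) ≠ 0 := by exact_mod_cast h
  rw [cotAngle, complexify_dotProduct, rot_complexify_dotProduct]
  have hd : zCoord (α i) - zCoord (α j) = 2 * Complex.I * ((α j 0 * α i 1 - α j 1 * α i 0 : ℝ) : ℂ)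
      /
      ((α i 0 - α i 1 * Complex.I) * (α j 0 - α j 1 * Complex.I)) := by
    rw [ei, ej, div_sub_div _ _ ci cj]
    congr 1
    push_cast
    ring
  have hs : zCoord (α i) + zCoord (α j) = 2 * ((α j 0 * α i 0 + α j 1 * α i 1 : ℝ) : ℂ) /
      ((α i 0 - α i 1 * Complex.I) * (α j 0 - α j 1 * Complex.I)) := by
    rw [ei, ej, div_add_div _ _ ci cj]
    congr 1
    push_cast
    linear_combination (-2 * α j 1 * α i 1 : ℂ) * Complex.I_sq
  rw [hd, hs, div_div_div_cancel_right₀ (mul_ne_zero ci cj)]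
  field_simp
  rw [Complex.I_sq]
  ring

lemma zCondition_one_iff {ι : Type*} [Fintype ι] [DecidableEq ι]
    (α : ι → EuclideanSpace ℝ (Fin 2)) (m : ι → ℕ) (j : ι)
    (h : ∀ i, i ≠ j → α j 0 * α i 1 - α j 1 * α i 0 ≠ 0) :
    ZCondition α m j 1 ↔ ∑ i ∈ Finset.univ.erase j,
      (m i : ℂ) * cotAngle (complexify α j) (complexify α i) = 0 := by
  have : ∀ i ∈ Finset.univ.erase j, (m i : ℂ) * (zCoord (α i) + zCoord (α j)) ^ (2 * 1 - 1) /
      (zCoord (α i) - zCoord (α j)) ^ (2 * 1 - 1) =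
      -Complex.I * ((m i : ℂ) * cotAngle (complexify α j) (complexify α i)) := by
    intro i hi
    rw [show 2 * 1 - 1 = 1 from rfl, pow_one, pow_one, mul_div_assoc,
      zCoord_ratio α i j (h i (Finset.ne_of_mem_erase hi))]
    ring
  rw [ZCondition, Finset.sum_congr rfl this, ← Finset.mul_sum, mul_eq_zero]
  simp

/-! ### Symmetric configurations are locus configurations -/

lemma cotAngle_self (a : Fin 2 → ℂ) : cotAngle a a = 0 := by
  have : rot a ⬝ᵥ a = 0 := by simp; ring
  rw [cotAngle, this, div_zero]

/-- An odd sum over a set with an involution-like symmetry that changes signs vanishes. -/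
lemma sum_odd_pow_eq_zero {ι : Type*} [Fintype ι] [DecidableEq ι] (σ : ι ≃ ι) (w t : ι → ℂ)
    (hw : ∀ i, w (σ i) = w i) (ht : ∀ i, t (σ i) = -t i) (j : ι) (hj : t j = 0) (s : ℕ) :
    ∑ i ∈ Finset.univ.erase j, w i * t i ^ (2 * s + 1) = 0 := by
  -- The omitted index can be restored since t j = 0; for cotangents this holds because division by
  -- zero gives 0.
  have h1 : ∑ i ∈ Finset.univ.erase j, w i * t i ^ (2 * s + 1) = ∑ i, w i * t i ^ (2 * s + 1) := by
    rw [← Finset.add_sum_erase _ _ (Finset.mem_univ j), hj]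
    simp
  have h2 : ∑ i, w i * t i ^ (2 * s + 1) = -∑ i, w i * t i ^ (2 * s + 1) := by
    conv_lhs => rw [← Equiv.sum_comp σ]
    rw [← Finset.sum_neg_distrib]
    refine Finset.sum_congr rfl fun i _ => ?_
    rw [hw, ht, Odd.neg_pow ⟨s, rfl⟩, mul_neg]
  rw [h1]
  exact self_eq_neg.1 h2

lemma reflectionAbout_apply (a x : EuclideanSpace ℝ (Fin 2)) :
    reflectionAbout a x = x - (2 * (inner ℝ a x / ‖a‖ ^ 2)) • a := by
  rw [reflectionAbout, Submodule.reflection_orthogonal_apply, Submodule.reflection_singleton_apply]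
  simp [two_smul, two_mul, add_smul]

/-- If the reflection about `a` maps the line orthogonal to `c` to the line orthogonal to `d`, then
`c` and `d` make opposite angles with `a`. -/
lemma dot_mul_det_of_map_reflectionAbout {a c d : EuclideanSpace ℝ (Fin 2)} (ha : a ≠ 0)
    (h : (Submodule.span ℝ {c})ᗮ.map (reflectionAbout a).toLinearMap = (Submodule.span ℝ {d})ᗮ) :
    (a 0 * c 0 + a 1 * c 1) * (a 0 * d 1 - a 1 * d 0) +
      (a 0 * c 1 - a 1 * c 0) * (a 0 * d 0 + a 1 * d 1) = 0 := by
  have hx : !₂[-c 1, c 0] ∈ (Submodule.span ℝ {c})ᗮ := by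
    rw [Submodule.mem_orthogonal_singleton_iff_inner_right]
    simp [PiLp.inner_apply, Fin.sum_univ_two]
    ring
  have h1 := Submodule.mem_map_of_mem (f := (reflectionAbout a).toLinearMap) hx
  rw [h, Submodule.mem_orthogonal_singleton_iff_inner_right] at h1
  have h2 : inner ℝ d (reflectionAbout a !₂[-c 1, c 0]) = 0 := h1
  have hn : ‖a‖ ^ 2 = a 0 ^ 2 + a 1 ^ 2 := by
    rw [EuclideanSpace.norm_sq_eq, Fin.sum_univ_two]; simp
  have hn0 : a 0 ^ 2 + a 1 ^ 2 ≠ 0 := by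
    rw [← hn]; exact pow_ne_zero _ (norm_ne_zero_iff.2 ha)
  rw [reflectionAbout_apply, hn] at h2
  simp [PiLp.inner_apply, Fin.sum_univ_two] at h2
  field_simp at h2
  linear_combination h2

lemma cotAngle_eq_neg_of {a c d : Fin 2 → ℂ} (hc : rot a ⬝ᵥ c ≠ 0) (hd : rot a ⬝ᵥ d ≠ 0)
    (h : (a ⬝ᵥ c) * (rot a ⬝ᵥ d) + (rot a ⬝ᵥ c) * (a ⬝ᵥ d) = 0) :
    cotAngle a d = -cotAngle a c := by
  rw [cotAngle, cotAngle, ← neg_div, div_eq_div_iff hd hc]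
  linear_combination h

/-- Turning by a right angle replaces cot by -tan. The convention 0⁻¹ = 0 covers c parallel to a or
b, so oddness under the reflection passes from one axis to the other. -/
lemma cotAngle_of_orthogonal {a b : Fin 2 → ℂ} (ha : a ⬝ᵥ a ≠ 0) (hb : rot a ⬝ᵥ b ≠ 0)
    (h : a ⬝ᵥ b = 0) (c : Fin 2 → ℂ) : cotAngle b c = -(cotAngle a c)⁻¹ := by
  have h1 : (a ⬝ᵥ a) * (b ⬝ᵥ c) = (rot a ⬝ᵥ b) * (rot a ⬝ᵥ c) := by
    rw [dotProduct_two] at h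
    simp only [dotProduct_two, rot_zero, rot_one]
    linear_combination (a 0 * c 0 + a 1 * c 1) * h
  have h2 : (a ⬝ᵥ a) * (rot b ⬝ᵥ c) = -(rot a ⬝ᵥ b) * (a ⬝ᵥ c) := by
    rw [dotProduct_two] at h
    simp only [dotProduct_two, rot_zero, rot_one]
    linear_combination (a 0 * c 1 - a 1 * c 0) * h
  rw [cotAngle, cotAngle, inv_div, ← mul_div_mul_left _ _ ha, h1, h2, neg_mul, div_neg,
    mul_div_mul_left _ _ hb]

theorem IsSymmetricConfig.isLocus {m m' n : ℕ} {α : Fin (n + 2) → EuclideanSpace ℝ (Fin 2)}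
    (h : IsSymmetricConfig m m' n α) : IsLocus (complexify α) (mult m m' n) := by
  have hdet : ∀ i j, i ≠ j → α i 0 * α j 1 - α i 1 * α j 0 ≠ 0 := fun i j hij =>
    (linearIndependent_pair_iff_det _ _).1 (h.noncollinear i j hij)
  have hl0 : Fin.last (n + 1) ≠ 0 := (Fin.last_pos).ne'
  have hα : ∀ j, α j ≠ 0 := by
    intro j hj
    have : ∃ i, j ≠ i := exists_ne j |>.imp fun i hi => hi.symm
    obtain ⟨i, hi⟩ := this
    exact hdet j i hi (by simp [hj])
  have hnorm : ∀ j, complexify α j ⬝ᵥ complexify α j ≠ 0 := by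
    intro j
    rw [complexify_dotProduct, Complex.ofReal_ne_zero]
    intro h0
    apply hα j
    ext k
    have h1 : α j 0 = 0 := by nlinarith [sq_nonneg (α j 0), sq_nonneg (α j 1)]
    have h2 : α j 1 = 0 := by nlinarith [sq_nonneg (α j 0), sq_nonneg (α j 1)]
    fin_cases k
    · simpa using h1
    · simpa using h2
  have hindep : ∀ i j, i ≠ j → rot (complexify α j) ⬝ᵥ complexify α i ≠ 0 := by
    intro i j hij
    rw [rot_complexify_dotProduct, Complex.ofReal_ne_zero]
    exact hdet j i hij.symm
  have hσ : ∀ i, ∃ k, (Submodule.span ℝ {α i})ᗮ.map (reflectionAbout (α 0)).toLinearMap =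
      (Submodule.span ℝ {α k})ᗮ := by
    intro i
    have : (Submodule.span ℝ {α i})ᗮ.map (reflectionAbout (α 0)).toLinearMap ∈ arrangement α := by
      rw [← h.symmetric]
      exact Set.mem_image_of_mem _ ⟨i, rfl⟩
    obtain ⟨k, hk⟩ := this
    exact ⟨k, hk.symm⟩
  choose σ hσ using hσ
  have hrel := fun i => dot_mul_det_of_map_reflectionAbout (hα 0) (hσ i)
  have hnorm0 : α 0 0 * α 0 0 + α 0 1 * α 0 1 ≠ 0 := by
    have := hnorm 0
    rwa [complexify_dotProduct, Complex.ofReal_ne_zero] at this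
  have horth : α 0 0 * α (Fin.last (n + 1)) 0 + α 0 1 * α (Fin.last (n + 1)) 1 = 0 := by
    have := h.orthogonal
    simp [PiLp.inner_apply, Fin.sum_univ_two] at this
    linear_combination this
  have hσ0 : σ 0 = 0 := by
    by_contra h0
    refine hdet 0 (σ 0) (Ne.symm h0) ((mul_eq_zero.1 ?_).resolve_left hnorm0)
    linear_combination hrel 0
  have hσl : σ (Fin.last (n + 1)) = Fin.last (n + 1) := by
    by_contra h0
    have h1 := hrel (Fin.last (n + 1))
    rw [horth, zero_mul, zero_add] at h1
    have h2 := (mul_eq_zero.1 h1).resolve_left (hdet 0 _ hl0.symm)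
    refine hdet _ _ h0 ((mul_eq_zero.1 ?_).resolve_left hnorm0)
    set l := Fin.last (n + 1)
    linear_combination (α 0 0 * α l 1 - α 0 1 * α l 0) * h2 -
      (α 0 0 * α (σ l) 1 - α 0 1 * α (σ l) 0) * horth
  have hinj : Function.Injective σ := by
    intro i j hij
    by_contra hne
    have h1 := hrel i
    have h2 := hrel j
    rw [← hij] at h2
    -- If i and j had the same image, its components along and across α₀ would solve two homogeneous
    -- linear equations whose determinant is, up to sign, this nonzero product; the image vector
    -- would be zero.
    have h3 := mul_ne_zero hnorm0 (hdet i j hne)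
    have hU : α 0 0 * α (σ i) 1 - α 0 1 * α (σ i) 0 = 0 := by
      refine (mul_eq_zero.1 ?_).resolve_left h3
      linear_combination (α 0 0 * α j 1 - α 0 1 * α j 0) * h1 -
        (α 0 0 * α i 1 - α 0 1 * α i 0) * h2
    have hV : α 0 0 * α (σ i) 0 + α 0 1 * α (σ i) 1 = 0 := by
      refine (mul_eq_zero.1 ?_).resolve_left h3
      linear_combination (α 0 0 * α i 0 + α 0 1 * α i 1) * h2 -
        (α 0 0 * α j 0 + α 0 1 * α j 1) * h1
    apply hα (σ i)
    ext k
    fin_cases k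
    · refine (mul_eq_zero.1 (?_ : _ * α (σ i) 0 = 0)).resolve_left hnorm0
      linear_combination α 0 0 * hV - α 0 1 * hU
    · refine (mul_eq_zero.1 (?_ : _ * α (σ i) 1 = 0)).resolve_left hnorm0
      linear_combination α 0 1 * hV + α 0 0 * hU
  let τ : Fin (n + 2) ≃ Fin (n + 2) :=
    Equiv.ofBijective σ (Finite.injective_iff_bijective.1 hinj)
  have hτ : ∀ i, τ i = σ i := fun _ => rfl
  have hmult : ∀ i, (mult m m' n (τ i) : ℂ) = mult m m' n i := by
    intro i
    rw [hτ, mult, mult]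
    have e0 : σ i = 0 ↔ i = 0 := ⟨fun h => hinj (h.trans hσ0.symm), fun h => h ▸ hσ0⟩
    have el : σ i = Fin.last (n + 1) ↔ i = Fin.last (n + 1) :=
      ⟨fun h => hinj (h.trans hσl.symm), fun h => h ▸ hσl⟩
    simp only [e0, el]
  have hcot : ∀ i, cotAngle (complexify α 0) (complexify α (τ i)) =
      -cotAngle (complexify α 0) (complexify α i) := by
    intro i
    rw [hτ]
    by_cases hi : i = 0
    · rw [hi, hσ0, cotAngle_self, neg_zero]
    · refine cotAngle_eq_neg_of (hindep _ _ hi) (hindep _ _ fun h0 => hi (hinj (h0.trans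
        hσ0.symm))) ?_
      rw [complexify_dotProduct, complexify_dotProduct, rot_complexify_dotProduct,
        rot_complexify_dotProduct]
      have := congrArg (fun t : ℝ => (t : ℂ)) (hrel i)
      push_cast at this ⊢
      exact this
  refine ⟨hnorm, hindep, fun j s hs => ?_⟩
  by_cases hj0 : j = 0
  · subst hj0
    exact sum_odd_pow_eq_zero τ (fun i => (mult m m' n i : ℂ)) _ hmult hcot 0 (cotAngle_self _) s
  by_cases hjl : j = Fin.last (n + 1)
  · subst hjl
    refine sum_odd_pow_eq_zero τ (fun i => (mult m m' n i : ℂ))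
      (fun i => cotAngle (complexify α (Fin.last (n + 1))) (complexify α i)) hmult (fun i => ?_) _
      (cotAngle_self _) s
    have key := cotAngle_of_orthogonal (hnorm 0) (hindep _ _ hl0)
      (by rw [complexify_dotProduct, horth, Complex.ofReal_zero])
    rw [key, key, hcot, inv_neg]
  · have h1 : mult m m' n j = 1 := by rw [mult, if_neg hj0, if_neg hjl]
    obtain rfl : s = 0 := by omega
    simpa using (zCondition_one_iff α _ j fun i hi => hdet j i hi.symm).1 (h.zCondition j hj0 hjl)

/-! ### Electrostatic equilibrium -/

section Stieltjes

variable {r : ℕ}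

/-- The weighted discriminant `∏ y_k^p (1 - y_k)^q ∏_{k ≠ l} (y_k - y_l)²`. -/
def weightedDisc (p q : ℕ) (y : Fin r → ℝ) : ℝ :=
  (∏ k, (y k ^ p * (1 - y k) ^ q)) * ∏ k, ∏ l, if k = l then 1 else (y k - y l) ^ 2

/-- The logarithm of the weighted discriminant. -/
def logDisc (p q : ℕ) (y : Fin r → ℝ) : ℝ :=
  (∑ k, (p * Real.log (y k) + q * Real.log (1 - y k))) + ∑ k, ∑ l, 2 * Real.log (y k - y l)

lemma continuous_weightedDisc (p q : ℕ) : Continuous (weightedDisc p q : (Fin r → ℝ) → ℝ) := by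
  unfold weightedDisc
  refine Continuous.mul (by fun_prop) ?_
  refine continuous_finsetProd _ fun k _ => continuous_finsetProd _ fun l _ => ?_
  split_ifs <;> fun_prop

lemma weightedDisc_ne_zero_iff {p q : ℕ} (hp : p ≠ 0) (hq : q ≠ 0) (y : Fin r → ℝ) :
    weightedDisc p q y ≠ 0 ↔
      (∀ k, y k ≠ 0) ∧ (∀ k, 1 - y k ≠ 0) ∧ Function.Injective y := by
  simp only [weightedDisc, mul_ne_zero_iff, Finset.prod_ne_zero_iff, Finset.mem_univ, true_imp_iff,
    pow_ne_zero_iff hp, pow_ne_zero_iff hq, forall_and, and_assoc]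
  refine and_congr_right fun _ => and_congr_right fun _ => ?_
  constructor
  · intro h k l hkl
    by_contra hne
    have := h k l
    rw [if_neg hne, hkl, sub_self] at this
    simp at this
  · intro h k l
    split_ifs with hkl
    · exact one_ne_zero
    · exact pow_ne_zero _ (sub_ne_zero.2 fun h' => hkl (h h'))

lemma log_weightedDisc {p q : ℕ} (hp : p ≠ 0) (hq : q ≠ 0) {y : Fin r → ℝ}
    (h : weightedDisc p q y ≠ 0) : Real.log (weightedDisc p q y) = logDisc p q y := by
  obtain ⟨h1, h2, h3⟩ := (weightedDisc_ne_zero_iff hp hq y).1 h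
  have hne : ∀ k l, (if k = l then (1 : ℝ) else (y k - y l) ^ 2) ≠ 0 := by
    intro k l
    split_ifs with hkl
    · exact one_ne_zero
    · exact pow_ne_zero _ (sub_ne_zero.2 fun h' => hkl (h3 h'))
  rw [weightedDisc, logDisc, Real.log_mul (left_ne_zero_of_mul h) (right_ne_zero_of_mul h),
    Real.log_prod (fun k _ => mul_ne_zero (pow_ne_zero _ (h1 k)) (pow_ne_zero _ (h2 k))),
    Real.log_prod (fun k _ => Finset.prod_ne_zero_iff.2 fun l _ => hne k l)]
  congr 1
  · refine Finset.sum_congr rfl fun k _ => ?_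
    rw [Real.log_mul (pow_ne_zero _ (h1 k)) (pow_ne_zero _ (h2 k)), Real.log_pow, Real.log_pow]
  · refine Finset.sum_congr rfl fun k _ => ?_
    rw [Real.log_prod fun l _ => hne k l]
    refine Finset.sum_congr rfl fun l _ => ?_
    split_ifs with hkl
    -- On the diagonal both sides are 0, since `Real.log 0 = 0`.
    · simp [hkl]
    · rw [Real.log_pow]; norm_num

lemma hasDerivAt_logDisc_update (p q : ℕ) {x : Fin r → ℝ} (h1 : ∀ k, x k ≠ 0)
    (h2 : ∀ k, 1 - x k ≠ 0) (h3 : Function.Injective x) (j : Fin r) :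
    HasDerivAt (fun t => logDisc p q (Function.update x j t))
      (p / x j - q / (1 - x j) + ∑ k, 4 / (x j - x k)) (x j) := by
  have hy : ∀ k, HasDerivAt (fun t => Function.update x j t k) (if k = j then 1 else 0) (x j) := by
    intro k
    by_cases hk : k = j
    · subst hk
      simpa using hasDerivAt_id' (x k)
    · simpa [hk] using hasDerivAt_const (x j) (x k)
  have hx : ∀ k, Function.update x j (x j) k = x k := fun k => by rw [Function.update_eq_self]
  have hA : ∀ k, HasDerivAt (fun t => p * Real.log (Function.update x j t k) +
      q * Real.log (1 - Function.update x j t k))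
      (if k = j then p / x j - q / (1 - x j) else 0) (x j) := by
    intro k
    have e1 := ((hy k).log (by rw [hx]; exact h1 k)).const_mul (p : ℝ)
    have e2 := (((hy k).const_sub 1).log (by rw [hx]; exact h2 k)).const_mul (q : ℝ)
    refine (e1.add e2).congr_deriv ?_
    rw [hx]
    split_ifs with hk
    · subst hk; ring
    · simp
  have hB : ∀ k l, HasDerivAt (fun t => 2 * Real.log (Function.update x j t k -
      Function.update x j t l)) ((if k = j then 2 / (x j - x l) else 0) +
        (if l = j then 2 / (x j - x k) else 0)) (x j) := by
    intro k l
    by_cases hkl : k = l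
    · subst hkl
      have : (fun t => 2 * Real.log (Function.update x j t k - Function.update x j t k)) =
          fun _ => (0 : ℝ) := by ext t; simp
      rw [this]
      refine (hasDerivAt_const _ _).congr_deriv ?_
      split_ifs with hk
      · simp [hk]
      · simp
    · have hne : x k - x l ≠ 0 := sub_ne_zero.2 fun h' => hkl (h3 h')
      refine ((((hy k).sub (hy l)).log (by simpa [hx] using hne)).const_mul 2).congr_deriv ?_
      simp only [Pi.sub_apply, hx]
      split_ifs with hk hl hl
      · exact absurd (hk.trans hl.symm) hkl
      · subst hk; ring
      · subst hl
        rw [← neg_sub (x k) (x l), div_neg]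
        ring
      · simp
  refine ((HasDerivAt.fun_sum fun k _ => hA k).add (HasDerivAt.fun_sum fun k _ =>
    HasDerivAt.fun_sum fun l _ => hB k l)).congr_deriv ?_
  simp only [Finset.sum_add_distrib, Finset.sum_ite_eq', Finset.mem_univ, if_true]
  rw [Finset.sum_comm]
  simp only [Finset.sum_ite_eq', Finset.mem_univ, if_true]
  rw [← Finset.sum_add_distrib]
  congr 1
  exact Finset.sum_congr rfl fun k _ => by ring

/-- Stieltjes: the electrostatic equilibrium on `(0, 1)` (the zeros of a Jacobi polynomial). -/
theorem exists_equilibrium (r : ℕ) {p q : ℕ} (hp : p ≠ 0) (hq : q ≠ 0) :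
    ∃ x : Fin r → ℝ, (∀ k, 0 < x k) ∧ (∀ k, x k < 1) ∧ Function.Injective x ∧
      ∀ j, p / x j - q / (1 - x j) + ∑ k, 4 / (x j - x k) = 0 := by
  have hne : (Set.Icc (0 : Fin r → ℝ) 1).Nonempty := ⟨0, by simp⟩
  obtain ⟨x, hx, hmax⟩ := (isCompact_Icc (a := (0 : Fin r → ℝ)) (b := 1)).exists_isMaxOn hne
    (continuous_weightedDisc p q).continuousOn
  have hnonneg : ∀ y ∈ Set.Icc (0 : Fin r → ℝ) 1, 0 ≤ weightedDisc p q y := by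
    intro y hy
    refine mul_nonneg (Finset.prod_nonneg fun k _ => mul_nonneg (pow_nonneg (hy.1 k) _)
      (pow_nonneg (sub_nonneg.2 (hy.2 k)) _)) ?_
    refine Finset.prod_nonneg fun k _ => Finset.prod_nonneg fun l _ => ?_
    split_ifs <;> positivity
  -- Equally spaced interior points have nonzero discriminant, so the maximum is positive and the
  -- maximiser has distinct coordinates inside (0, 1).
  let y : Fin r → ℝ := fun k => (k + 1 : ℝ) / (r + 1)
  have hr : (0 : ℝ) < r + 1 := by positivity
  have hy0 : ∀ k, 0 < y k := fun k => by positivity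
  have hy1 : ∀ k, y k < 1 := fun k => by
    rw [div_lt_one hr]
    have : (k : ℝ) < r := by exact_mod_cast k.2
    linarith
  have hyI : y ∈ Set.Icc (0 : Fin r → ℝ) 1 := ⟨fun k => (hy0 k).le, fun k => (hy1 k).le⟩
  have hyne : weightedDisc p q y ≠ 0 := by
    rw [weightedDisc_ne_zero_iff hp hq]
    refine ⟨fun k => (hy0 k).ne', fun k => (sub_pos.2 (hy1 k)).ne', fun k l hkl => ?_⟩
    have := (div_left_inj' hr.ne').1 hkl
    have h2 : (k : ℝ) = l := by linarith
    exact Fin.ext (by exact_mod_cast h2)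
  have hpos : 0 < weightedDisc p q x :=
    ((hnonneg y hyI).lt_of_ne' hyne).trans_le (hmax hyI)
  obtain ⟨h1, h2, h3⟩ := (weightedDisc_ne_zero_iff hp hq x).1 hpos.ne'
  have hx0 : ∀ k, 0 < x k := fun k => (hx.1 k).lt_of_ne' (h1 k)
  have hx1 : ∀ k, x k < 1 := fun k => (hx.2 k).lt_of_ne fun h => h2 k (by simp [h])
  refine ⟨x, hx0, hx1, h3, fun j => ?_⟩
  refine IsLocalMax.hasDerivAt_eq_zero ?_ (hasDerivAt_logDisc_update p q h1 h2 h3 j)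
  have hcont : Continuous fun t => weightedDisc p q (Function.update x j t) :=
    (continuous_weightedDisc p q).comp (continuous_const.update j continuous_id)
  have ev1 : ∀ᶠ t in nhds (x j), 0 < weightedDisc p q (Function.update x j t) :=
    hcont.continuousAt.eventually_const_lt (by simpa using hpos)
  filter_upwards [ev1, Ioo_mem_nhds (hx0 j) (hx1 j)] with t ht hI
  rw [Function.update_eq_self, ← log_weightedDisc hp hq ht.ne', ← log_weightedDisc hp hq hpos.ne']
  refine Real.log_le_log ht (hmax ⟨fun k => ?_, fun k => ?_⟩)
  · by_cases hk : k = j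
    · subst hk; simpa using hI.1.le
    · simpa [hk] using hx.1 k
  · by_cases hk : k = j
    · subst hk; simpa using hI.2.le
    · simpa [hk] using hx.2 k

end Stieltjes

/-! ### Explicit symmetric configurations of unit vectors -/

/-- The unit vector with second coordinate `t` in the right half plane. -/
def unitVec (t : ℝ) : EuclideanSpace ℝ (Fin 2) := !₂[√(1 - t ^ 2), t]

@[simp] lemma unitVec_zero (t : ℝ) : unitVec t 0 = √(1 - t ^ 2) := rfl

@[simp] lemma unitVec_one (t : ℝ) : unitVec t 1 = t := rfl

/-- The vectors `(1, 0)`, `(√(1 - tᵢ²), tᵢ)`, `(0, 1)`. -/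
def unitConfig {n : ℕ} (t : Fin n → ℝ) : Fin (n + 2) → EuclideanSpace ℝ (Fin 2) :=
  Fin.cons !₂[1, 0] (Fin.snoc (α := fun _ => EuclideanSpace ℝ (Fin 2)) (fun i => unitVec (t i))
      !₂[0, 1])

section

variable {n : ℕ} (t : Fin n → ℝ)

@[simp] lemma unitConfig_zero : unitConfig t 0 = !₂[1, 0] := rfl

@[simp] lemma unitConfig_last : unitConfig t (Fin.last (n + 1)) = !₂[0, 1] := by
  rw [← Fin.succ_last, unitConfig, Fin.cons_succ, Fin.snoc_last]

@[simp] lemma unitConfig_mid (i : Fin n) : unitConfig t i.castSucc.succ = unitVec (t i) := by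
  rw [unitConfig, Fin.cons_succ, Fin.snoc_castSucc]

/-- Case distinction on the position in a configuration. -/
lemma forall_fin_ends {P : Fin (n + 2) → Prop} (h0 : P 0) (hl : P (Fin.last (n + 1)))
    (hm : ∀ i : Fin n, P i.castSucc.succ) (i : Fin (n + 2)) : P i := by
  refine Fin.cases h0 (fun k => ?_) i
  refine Fin.lastCases ?_ (fun k => hm k) k
  rwa [Fin.succ_last]

lemma sum_fin_ends {M : Type*} [AddCommMonoid M] (f : Fin (n + 2) → M) :
    ∑ i, f i = f 0 + (∑ i : Fin n, f i.castSucc.succ + f (Fin.last (n + 1))) := by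
  rw [Fin.sum_univ_succ, Fin.sum_univ_castSucc, Fin.succ_last]

variable {t}

/-- Collinear unit vectors agree up to sign; the middle ones have positive first coordinate and are
determined by the second, and tᵢ ≠ 0 separates them from (1, 0). -/
lemma unitConfig_det_ne (ht0 : ∀ i, t i ≠ 0) (ht1 : ∀ i, t i ^ 2 < 1)
    (hinj : Function.Injective t) (i j : Fin (n + 2)) (hij : i ≠ j) :
    unitConfig t i 0 * unitConfig t j 1 - unitConfig t i 1 * unitConfig t j 0 ≠ 0 := by
  have hc : ∀ k, 0 < √(1 - t k ^ 2) := fun k => Real.sqrt_pos.2 (sub_pos.2 (ht1 k))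
  revert j
  refine forall_fin_ends (P := fun i => ∀ j, i ≠ j →
    unitConfig t i 0 * unitConfig t j 1 - unitConfig t i 1 * unitConfig t j 0 ≠ 0) ?_ ?_ (fun k =>
        ?_) i
  · refine forall_fin_ends (fun h => absurd rfl h) (fun _ => by simp) fun l _ => ?_
    simpa using ht0 l
  · refine forall_fin_ends (fun _ => by simp) (fun h => absurd rfl h) fun l _ => ?_
    simpa using (hc l).ne'
  · refine forall_fin_ends (fun _ => by simpa using ht0 k) (fun _ => by simpa using (hc k).ne')
      fun l hkl => ?_
    rw [unitConfig_mid, unitConfig_mid, unitVec_zero, unitVec_zero, unitVec_one, unitVec_one]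
    intro h
    have hne : t k ≠ t l := fun h' => hkl (by rw [hinj h'])
    have e1 := Real.sq_sqrt (sub_pos.2 (ht1 k)).le
    have e2 := Real.sq_sqrt (sub_pos.2 (ht1 l)).le
    have h1 := hc k
    have h2 := hc l
    set a := √(1 - t k ^ 2)
    set b := √(1 - t l ^ 2)
    have h3 : (t l - t k) * (t l + t k) = 0 := by
      have : (a * t l) ^ 2 = (t k * b) ^ 2 := by rw [sub_eq_zero.1 h]
      rw [mul_pow, mul_pow, e1, e2] at this
      linear_combination this
    have h4 : t l + t k = 0 := (mul_eq_zero.1 h3).resolve_left (sub_ne_zero.2 hne.symm)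
    have h5 : t l * (a + b) = 0 := by linear_combination h + b * h4
    exact ht0 l ((mul_eq_zero.1 h5).resolve_right (by positivity))

lemma reflectionAbout_map_orthogonal (a c : EuclideanSpace ℝ (Fin 2)) :
    (Submodule.span ℝ {c})ᗮ.map (reflectionAbout a).toLinearMap =
      (Submodule.span ℝ {reflectionAbout a c})ᗮ := by
  rw [Submodule.map_orthogonal_equiv, Submodule.map_span, Set.image_singleton]
  rfl

lemma span_neg_singleton {E : Type*} [AddCommGroup E] [Module ℝ E] (v : E) :
    Submodule.span ℝ {-v} = Submodule.span ℝ {v} := by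
  rw [← Set.neg_singleton, Submodule.span_neg]

lemma reflectionAbout_e0 (c : EuclideanSpace ℝ (Fin 2)) :
    reflectionAbout !₂[1, 0] c = !₂[-c 0, c 1] := by
  rw [reflectionAbout_apply, EuclideanSpace.norm_sq_eq]
  ext k
  fin_cases k
  · simp [PiLp.inner_apply, Fin.sum_univ_two]; ring
  · simp [PiLp.inner_apply, Fin.sum_univ_two]

lemma unitConfig_symmetric (σ : Fin n → Fin n) (hσ : ∀ i, t (σ i) = -t i)
    (hσσ : ∀ i, σ (σ i) = i) :
    (fun L => L.map (reflectionAbout (unitConfig t 0)).toLinearMap) '' arrangement (unitConfig t) =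
      arrangement (unitConfig t) := by
  have key : ∀ i, ∃ k, (Submodule.span ℝ {unitConfig t i})ᗮ.map
      (reflectionAbout (unitConfig t 0)).toLinearMap = (Submodule.span ℝ {unitConfig t k})ᗮ ∧
      (Submodule.span ℝ {unitConfig t k})ᗮ.map (reflectionAbout (unitConfig t 0)).toLinearMap =
      (Submodule.span ℝ {unitConfig t i})ᗮ := by
    have h : ∀ i, (Submodule.span ℝ {unitConfig t (Fin.castSucc i).succ})ᗮ.map
        (reflectionAbout (unitConfig t 0)).toLinearMap =
        (Submodule.span ℝ {unitConfig t (Fin.castSucc (σ i)).succ})ᗮ := by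
      intro i
      rw [reflectionAbout_map_orthogonal, unitConfig_zero, reflectionAbout_e0, unitConfig_mid,
        unitConfig_mid, ← span_neg_singleton (unitVec (t (σ i)))]
      congr 3
      ext k
      fin_cases k <;> simp [hσ]
    refine forall_fin_ends ⟨0, ?_⟩ ⟨Fin.last (n + 1), ?_⟩ (fun i => ⟨_, h i, ?_⟩)
    · rw [and_self, reflectionAbout_map_orthogonal, unitConfig_zero, reflectionAbout_e0,
        ← span_neg_singleton !₂[(1 : ℝ), 0]]
      congr 3
      ext k
      fin_cases k <;> simp
    · rw [and_self, reflectionAbout_map_orthogonal, unitConfig_zero, reflectionAbout_e0,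
        unitConfig_last]
      congr 3
      ext k
      fin_cases k <;> simp
    · rw [h, hσσ]
  ext L
  constructor
  · rintro ⟨_, ⟨i, rfl⟩, rfl⟩
    obtain ⟨k, hk, -⟩ := key i
    exact ⟨k, hk.symm⟩
  · rintro ⟨i, rfl⟩
    obtain ⟨k, -, hk⟩ := key i
    exact ⟨_, ⟨k, rfl⟩, hk⟩

end

/-! ### The conditions on zᵢ as equilibrium equations -/

/-- The cotangent of the angle between two real vectors. -/
def realCot (a c : EuclideanSpace ℝ (Fin 2)) : ℝ :=
  (a 0 * c 0 + a 1 * c 1) / (a 0 * c 1 - a 1 * c 0)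

lemma cotAngle_complexify {ι : Type*} (α : ι → EuclideanSpace ℝ (Fin 2)) (i j : ι) :
    cotAngle (complexify α i) (complexify α j) = (realCot (α i) (α j) : ℝ) := by
  rw [cotAngle, complexify_dotProduct, rot_complexify_dotProduct, realCot, Complex.ofReal_div]

lemma realCot_self (a : EuclideanSpace ℝ (Fin 2)) : realCot a a = 0 := by
  rw [realCot, mul_comm (a 1) (a 0), sub_self, div_zero]

lemma zCondition_one_of_sum {ι : Type*} [Fintype ι] [DecidableEq ι]
    (α : ι → EuclideanSpace ℝ (Fin 2)) (m : ι → ℕ) (j : ι)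
    (h : ∀ i, i ≠ j → α j 0 * α i 1 - α j 1 * α i 0 ≠ 0)
    (hs : ∑ i, (m i : ℝ) * realCot (α j) (α i) = 0) : ZCondition α m j 1 := by
  rw [zCondition_one_iff α m j h]
  rw [← Finset.add_sum_erase _ _ (Finset.mem_univ j), realCot_self, mul_zero, zero_add] at hs
  simp only [cotAngle_complexify]
  exact_mod_cast hs

/-- Adding the contributions of a mirror pair removes √(1 - s²), leaving a Coulomb force in the
squared variables. -/
lemma realCot_unitVec_add_neg {s t : ℝ} (ht1 : t ^ 2 < 1) (hs1 : s ^ 2 < 1)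
    (hst : s ^ 2 ≠ t ^ 2) :
    realCot (unitVec t) (unitVec s) + realCot (unitVec t) (unitVec (-s)) =
      2 * √(1 - t ^ 2) * t / (s ^ 2 - t ^ 2) := by
  simp only [realCot, unitVec_zero, unitVec_one, neg_sq]
  have e1 := Real.sq_sqrt (sub_pos.2 ht1).le
  have e2 := Real.sq_sqrt (sub_pos.2 hs1).le
  set a := √(1 - t ^ 2)
  set b := √(1 - s ^ 2)
  have h1 : (a * s - t * b) * (a * -s - t * b) = t ^ 2 - s ^ 2 := by
    linear_combination -s ^ 2 * e1 + t ^ 2 * e2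
  have h2 : (a * s - t * b) * (a * -s - t * b) ≠ 0 := by
    rw [h1]; exact sub_ne_zero.2 hst.symm
  rw [div_add_div _ _ (left_ne_zero_of_mul h2) (right_ne_zero_of_mul h2), h1,
    div_eq_div_iff (sub_ne_zero.2 hst.symm) (sub_ne_zero.2 hst)]
  linear_combination (-2 * a * t * (s ^ 2 - t ^ 2)) * e2

lemma realCot_unitVec_neg {t : ℝ} (ht1 : t ^ 2 < 1) : realCot (unitVec t) (unitVec (-t)) =
    -((1 - t ^ 2 - t ^ 2) / (2 * √(1 - t ^ 2) * t)) := by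
  simp only [realCot, unitVec_zero, unitVec_one, neg_sq]
  rw [Real.mul_self_sqrt (sub_pos.2 ht1).le, ← neg_div_neg_eq, ← neg_div]
  congr 1 <;> ring

/-- Existence of the configurations. -/
theorem exists_isSymmetricConfig (m m' r : ℕ) :
    ∃ α, IsSymmetricConfig m m' (r + r) α := by
  -- An axis of multiplicity m gives charge 2m, and the interaction of a vector with its own mirror
  -- image adds 1 at each endpoint. So the charges are nonzero even when m or m̃ is.
  obtain ⟨x, hx0, hx1, hinj, heq⟩ := exists_equilibrium r (p := 2 * m + 1) (q := 2 * m' + 1)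
    (by omega) (by omega)
  let s : Fin r → ℝ := fun k => √(x k)
  have hs0 : ∀ k, 0 < s k := fun k => Real.sqrt_pos.2 (hx0 k)
  have hsq : ∀ k, s k ^ 2 = x k := fun k => Real.sq_sqrt (hx0 k).le
  have hsinj : Function.Injective s := fun k l h => hinj (by rw [← hsq, ← hsq, h])
  let t : Fin (r + r) → ℝ := Fin.append s (fun k => -s k)
  have tl : ∀ k, t (Fin.castAdd r k) = s k := fun k => Fin.append_left _ _ k
  have tr : ∀ k, t (Fin.natAdd r k) = -s k := fun k => Fin.append_right _ _ k
  have hcase : ∀ i, ∃ k, (t i = s k ∨ t i = -s k) := fun i =>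
    Fin.addCases (fun k => ⟨k, Or.inl (tl k)⟩) (fun k => ⟨k, Or.inr (tr k)⟩) i
  have ht0 : ∀ i, t i ≠ 0 := by
    intro i
    obtain ⟨k, h | h⟩ := hcase i <;> rw [h]
    · exact (hs0 k).ne'
    · exact (neg_neg_of_pos (hs0 k)).ne
  have htsq : ∀ i, ∃ k, t i ^ 2 = s k ^ 2 := by
    intro i
    obtain ⟨k, h | h⟩ := hcase i
    · exact ⟨k, by rw [h]⟩
    · exact ⟨k, by rw [h, neg_sq]⟩
  have ht1 : ∀ i, t i ^ 2 < 1 := by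
    intro i
    obtain ⟨k, h⟩ := htsq i
    rw [h, hsq]
    exact hx1 k
  have htinj : Function.Injective t := by
    intro i j
    refine Fin.addCases (fun k => ?_) (fun k => ?_) i <;>
      refine Fin.addCases (fun l => ?_) (fun l => ?_) j <;> simp only [tl, tr]
    · exact fun h => by rw [hsinj h]
    · intro h; linarith [hs0 k, hs0 l]
    · intro h; linarith [hs0 k, hs0 l]
    · exact fun h => by rw [hsinj (neg_injective h)]
  let σ : Fin (r + r) → Fin (r + r) := Fin.addCases (Fin.natAdd r) (Fin.castAdd r)
  have sl : ∀ k, σ (Fin.castAdd r k) = Fin.natAdd r k := fun k => Fin.addCases_left k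
  have sr : ∀ k, σ (Fin.natAdd r k) = Fin.castAdd r k := fun k => Fin.addCases_right k
  have hdet := unitConfig_det_ne ht0 ht1 htinj
  refine ⟨unitConfig t, fun i j hij => (linearIndependent_pair_iff_det _ _).2 (hdet i j hij), ?_,
    unitConfig_symmetric σ (fun i => ?_) (fun i => ?_), ?_⟩
  · simp [PiLp.inner_apply, Fin.sum_univ_two]
  · refine Fin.addCases (fun k => ?_) (fun k => ?_) i
    · rw [sl, tl, tr]
    · rw [sr, tl, tr, neg_neg]
  · refine Fin.addCases (fun k => ?_) (fun k => ?_) i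
    · rw [sl, sr]
    · rw [sr, sl]
  refine forall_fin_ends (fun h => absurd rfl h) (fun _ h => absurd rfl h) fun i _ _ => ?_
  refine zCondition_one_of_sum _ _ _ (fun k hk => hdet _ _ hk.symm) ?_
  have hl0 : Fin.last (r + r + 1) ≠ 0 := (Fin.last_pos).ne'
  have m0 : mult m m' (r + r) 0 = m := if_pos rfl
  have ml : mult m m' (r + r) (Fin.last (r + r + 1)) = m' := by
    rw [mult, if_neg hl0, if_pos rfl]
  have mm : ∀ k : Fin (r + r), mult m m' (r + r) k.castSucc.succ = 1 := by
    intro k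
    rw [mult, if_neg (Fin.succ_ne_zero _), if_neg]
    rw [← Fin.succ_last, Fin.succ_inj]
    exact (Fin.castSucc_lt_last k).ne
  simp only [sum_fin_ends, m0, ml, mm, unitConfig_zero, unitConfig_last, unitConfig_mid,
    Fin.sum_univ_add, tl, tr, Nat.cast_one, one_mul]
  rw [← Finset.sum_add_distrib]
  obtain ⟨j, hj⟩ := htsq i
  have hti0 := ht0 i
  have hti1 := ht1 i
  have hjcase : t i = s j ∨ t i = -s j := sq_eq_sq_iff_eq_or_eq_neg.1 hj
  -- From here both signs of the chosen vector are treated together: the pair with index j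
  -- contributes only the mirror image, the other pairs give forces.
  generalize t i = u at hj hti0 hti1 hjcase ⊢
  have hself : realCot (unitVec u) (unitVec (s j)) + realCot (unitVec u) (unitVec (-s j)) =
      -((1 - u ^ 2 - u ^ 2) / (2 * √(1 - u ^ 2) * u)) := by
    rcases hjcase with h | h
    · rw [← h, realCot_self, zero_add, realCot_unitVec_neg hti1]
    · have : s j = -u := by rw [h, neg_neg]
      rw [this, neg_neg, realCot_self, add_zero, realCot_unitVec_neg hti1]
  have hother : ∀ k ∈ Finset.univ.erase j,
      realCot (unitVec u) (unitVec (s k)) + realCot (unitVec u) (unitVec (-s k)) =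
        -(√(1 - u ^ 2) * u / 2) * (4 / (x j - x k)) := by
    intro k hk
    have hne : x k ≠ x j := fun h => Finset.ne_of_mem_erase hk (hinj h)
    rw [realCot_unitVec_add_neg hti1 (by rw [hsq]; exact hx1 k) (by rwa [hj, hsq, hsq]), hj,
      hsq, hsq]
    have h1 := sub_ne_zero.2 hne
    have h2 := sub_ne_zero.2 hne.symm
    field_simp
    ring
  have h := heq j
  -- The k = j term of the equilibrium equation is 4/0 = 0.
  rw [← Finset.add_sum_erase _ _ (Finset.mem_univ j), sub_self, div_zero, zero_add] at h
  rw [← Finset.add_sum_erase _ _ (Finset.mem_univ j), hself, Finset.sum_congr rfl hother,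
    ← Finset.mul_sum, eq_neg_of_add_eq_zero_right h]
  have hux : u ^ 2 = x j := by rw [hj, hsq]
  have hc := Real.sq_sqrt (sub_pos.2 hti1).le
  have hc0 := Real.sqrt_pos.2 (sub_pos.2 hti1)
  rw [← hux]
  simp only [realCot, unitVec_zero, unitVec_one]
  set c := √(1 - u ^ 2)
  rw [← hc]
  have hc1 := hc0.ne'
  simp
  field_simp
  ring

end BakerAkhiezer

end

theorem theorem3p2 (m m' n : ℕ) :
    (Even n → ∃ α : Fin (n + 2) → EuclideanSpace ℝ (Fin 2),
      BakerAkhiezer.IsSymmetricConfig m m' n α) ∧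
    (∀ α : Fin (n + 2) → EuclideanSpace ℝ (Fin 2),
      BakerAkhiezer.IsSymmetricConfig m m' n α →
        ∃ φ : (Fin 2 → ℂ) → (Fin 2 → ℂ) → ℂ,
          BakerAkhiezer.IsBAFunction (BakerAkhiezer.complexify α)
            (BakerAkhiezer.mult m m' n) φ) := by
  constructor
  · rintro ⟨r, rfl⟩
    exact BakerAkhiezer.exists_isSymmetricConfig m m' r
  · intro α h
    exact h.isLocus.exists_isBAFunction
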